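/- Let $s\in(0,\tfrac12)\cup(\tfrac12,1)$, $\alpha\in(\max(0,2s-1),1]$, $L>0$, $\delta>0$, $\Omega_1=[-L,L]$, $\Omega_1^\delta=(-L-\delta,L+\delta)$. Let $u:\mathbb R\to\mathbb R$ satisfy $u=g$ outside $\Omega_1$, where $g\in L^\infty(\mathbb R)$ has bounded support and $g=0$ on $\Omega_1$, and let $u\in C^{1,\alpha}(\bar\Omega_1^\delta)$. Put $$(-\Delta)^su(x)=c_{1,s}\,\mathrm{P.V.}\!\int_{\mathbb R}\frac{u(x)-u(y)}{|x-y|^{1+2s}}\,dy,\qquad c_{1,\sigma}=\frac{2^{2\sigma}|\sigma|\,\Gamma(\frac12+\sigma)}{\sqrt\pi\,\Gamma(1-\sigma)} .$$ For $N\ge1$ let $h=2L/N$, $x_i=-L+ih$ $(i\in\mathbb Z)$, $u_i=u(x_i)$, $(-\Delta)_hv_i=-(v_{i-1}-2v_i+v_{i+1})/h^2$, $\bar\phi(y)=\max(0,1-|y|/h)$, and for $i=0,N$ let $\phi_i(y)=\bar\phi(y-x_i)\chi_{[-L,L]}(y)$. Set $$\bar\omega_k=c_{1,s-1}\int_{-h}^h|kh-y|^{1-2s}\bar\phi(y)\,dy,\qquad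 w_k=(-\Delta)_h\bar\omega_k,$$ $$R_i=c_{1,s-1}\int_{\mathbb R}|x_i-y|^{1-2s}\bigl(u_0\phi_0(y)+u_N\phi_N(y)+g(y)\bigr)dy ,$$ $\bar\omega^M_0=0$ if $w_1\ge0$ and $\bar\omega^M_0=\bar\omega_0$ if $w_1<0$, $\bar\omega_k^M=\bar\omega_k$ for $k\ne0$, and $w^M_k=(-\Delta)_h\bar\omega^M_k$. The modified scheme at $x_i$, $1\le i\le N-1$, is $$(-\Delta)^s_{h,M}u(x_i)=\sum_{j=1}^{N-1}w^M_{j-i}u_j+(-\Delta)_hR_i+\sum_{j\in\{0,N\}}\bigl(w^M_{j-i}-w_{j-i}\bigr)u_j ,$$ where the last sum makes the replacement $\bar\omega_0\mapsto\bar\omega_0^M$ also in the contributions of the two end nodes; it vanishes if $\bar\omega_0^M=\bar\omega_0$ or $u(\pm L)=0$. Then there is a constant $C$ depending only on $s,\alpha,L,\delta$ such that, whenever $M\ge0$ bounds $|u|$, $|u'|$ and the $\alpha$-Hölder constant of $u'$ on $\bar\Omega_1^\delta$ as well as $\|g\|_{L^\infty(\mathbb R)}$, for every $N\ge1$ with $4h<\delta$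 the principal values $(-\Delta)^su(x_i)$, $1\le i\le N-1$, exist and $$\|((-\Delta)^s-(-\Delta)^s_{h,M})u\|_\infty\le CM\,h^{1+\alpha-2s},\qquad \|((-\Delta)^s-(-\Delta)^s_{h,M})u\|_2\le CM\,h^{1+\alpha-2s},$$ where $\|v\|_\infty=\max_{1\le i\le N-1}|v_i|$ and $\|v\|_2=\bigl(h\sum_{i=1}^{N-1}v_i^2\bigr)^{1/2}$. -/

import Mathlib

open MeasureTheory Set Filter Topology

noncomputable section

/-- The one-dimensional constant `c_{1,σ} = 2^{2σ} |σ| Γ(1/2 + σ) / (√π Γ(1 - σ))`.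
For `σ > 0` it is the constant of the integral fractional Laplacian, for `σ < 0` (where
`|σ| = -σ`) it is the constant of the Riesz potential `(-Δ)^σ`. -/
def fracConst (σ : ℝ) : ℝ :=
  (2 : ℝ) ^ (2 * σ) * |σ| * Real.Gamma (1 / 2 + σ) / (√Real.pi * Real.Gamma (1 - σ))

/-- The truncated integral `c_{1,s} ∫_{|x - y| > ε} (u(x) - u(y)) / |x - y|^{1+2s} dy`. -/
def truncFracLap (s : ℝ) (u : ℝ → ℝ) (x ε : ℝ) : ℝ :=
  fracConst s * ∫ y in {y : ℝ | ε < |x - y|}, (u x - u y) / |x - y| ^ (1 + 2 * s)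

/-- The principal value integral defining `(-Δ)^s u(x)` exists and equals `ℓ`. -/
structure HasFracLap (s : ℝ) (u : ℝ → ℝ) (x ℓ : ℝ) : Prop where
  integrableOn : ∀ ε : ℝ, 0 < ε →
    IntegrableOn (fun y : ℝ => (u x - u y) / |x - y| ^ (1 + 2 * s)) {y : ℝ | ε < |x - y|} volume
  tendsto : Tendsto (truncFracLap s u x) (𝓝[>] (0 : ℝ)) (𝓝 ℓ)

/-- The integral fractional Laplacian `(-Δ)^s u(x)`, the limit of the truncated integrals. -/
def fracLap (s : ℝ) (u : ℝ → ℝ) (x : ℝ) : ℝ :=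
  limUnder (𝓝[>] (0 : ℝ)) (truncFracLap s u x)

/-- `u` belongs to `C^{1,α}([a,b])` and `M` bounds `|u|`, `|u'|` and the `α`-Hölder constant of
`u'` on `[a,b]`. (For `α > 0` a function lies in `C^{1,α}([a,b])` iff this holds for some `M`.) -/
structure C1HolderBound (α a b M : ℝ) (u : ℝ → ℝ) : Prop where
  differentiableOn : DifferentiableOn ℝ u (Icc a b)
  abs_le : ∀ x ∈ Icc a b, |u x| ≤ M
  abs_deriv_le : ∀ x ∈ Icc a b, |derivWithin u (Icc a b) x| ≤ M
  holder : ∀ x ∈ Icc a b, ∀ y ∈ Icc a b,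
    |derivWithin u (Icc a b) x - derivWithin u (Icc a b) y| ≤ M * |x - y| ^ α

namespace FracScheme

/-- The mesh size `h = 2L/N`. -/
def mesh (L : ℝ) (N : ℕ) : ℝ := 2 * L / N

/-- The grid points `x_i = -L + i h`, `i ∈ ℤ`. -/
def node (L : ℝ) (N : ℕ) (i : ℤ) : ℝ := -L + i * mesh L N

/-- The hat function `φ̄₁(y) = 1 - |y|/h` on `(-h,h)`, zero elsewhere. -/
def hat (h y : ℝ) : ℝ := (Ioo (-h) h).indicator (fun t => 1 - |t| / h) y

/-- The Lagrange basis function `φ_i = φ̄₁(· - x_i) χ_{I_i}`, `I_i = [x_{i-1}, x_{i+1}] ∩ [-L,L]`. -/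
def basisFun (L : ℝ) (N : ℕ) (i : ℤ) (y : ℝ) : ℝ :=
  (Icc (node L N (i - 1)) (node L N (i + 1)) ∩ Icc (-L) L).indicator
    (fun t => hat (mesh L N) (t - node L N i)) y

/-- The three-point discretization `(-Δ)_h v_i = -(v_{i-1} - 2 v_i + v_{i+1}) / h²`. -/
def discNegLap (h : ℝ) (v : ℤ → ℝ) (i : ℤ) : ℝ :=
  -(v (i - 1) - 2 * v i + v (i + 1)) / h ^ 2

/-- `ω̄_k = c_{1,s-1} ∫_{-h}^{h} |k h - y|^{1-2s} φ̄₁(y) dy`. -/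
def omegaBar (s h : ℝ) (k : ℤ) : ℝ :=
  fracConst (s - 1) * ∫ y in (-h)..h, |k * h - y| ^ (1 - 2 * s) * hat h y

/-- The weights `w_k = (-Δ)_h ω̄_k`. -/
def weight (s h : ℝ) (k : ℤ) : ℝ := discNegLap h (omegaBar s h) k

/-- `ω̄^M_0 = 0` if `w_1 ≥ 0` and `ω̄^M_0 = ω̄_0` if `w_1 < 0`; `ω̄^M_k = ω̄_k` for `k ≠ 0`. -/
def omegaBarM (s h : ℝ) (k : ℤ) : ℝ :=
  if k = 0 ∧ 0 ≤ weight s h 1 then 0 else omegaBar s h k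

/-- The modified weights `w^M_k = (-Δ)_h ω̄^M_k`; they equal `w_k` for `|k| ≥ 2`. -/
def weightM (s h : ℝ) (k : ℤ) : ℝ := discNegLap h (omegaBarM s h) k

/-- `R_i = c_{1,s-1} ∫_ℝ |x_i - y|^{1-2s} (u_0 φ_0(y) + u_N φ_N(y) + g(y)) dy`. -/
def boundaryTerm (s L : ℝ) (N : ℕ) (u g : ℝ → ℝ) (i : ℤ) : ℝ :=
  fracConst (s - 1) * ∫ y : ℝ, |node L N i - y| ^ (1 - 2 * s) *
    (u (node L N 0) * basisFun L N 0 y + u (node L N N) * basisFun L N N y + g y)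

/-- The modified scheme
`(-Δ)^s_{h,M} u(x_i) = ∑_{j=1}^{N-1} w^M_{j-i} u_j + (-Δ)_h R_i + ∑_{j ∈ {0,N}} (w^M_{j-i} - w_{j-i}) u_j`.
The last sum applies the change `ω̄_0 ↦ ω̄^M_0` to the contributions of the two end nodes, which
`R_i` contains with the unmodified weights; it can be nonzero only if `ω̄_0` is replaced by `0`,
`i ∈ {1, N-1}`, and the value of `u` at the neighbouring end node is nonzero. -/
def modifiedScheme (s L : ℝ) (N : ℕ) (u g : ℝ → ℝ) (i : ℤ) : ℝ :=
  (∑ j ∈ Finset.Icc (1 : ℤ) (N - 1), weightM s (mesh L N) (j - i) * u (node L N j))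
    + discNegLap (mesh L N) (boundaryTerm s L N u g) i
    + ((weightM s (mesh L N) (0 - i) - weight s (mesh L N) (0 - i)) * u (node L N 0)
      + (weightM s (mesh L N) (N - i) - weight s (mesh L N) (N - i)) * u (node L N N))

/-- The truncation error at the interior nodes `x_1, …, x_{N-1}` (entry `k` belongs to `x_{k+1}`). -/
def truncError (s L : ℝ) (N : ℕ) (u g : ℝ → ℝ) : Fin (N - 1) → ℝ := fun k =>
  fracLap s u (node L N ((k : ℤ) + 1)) - modifiedScheme s L N u g ((k : ℤ) + 1)

/-- The discrete `l^∞` norm of a grid function (the sup norm of the function space). -/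
def normInf {n : ℕ} (v : Fin n → ℝ) : ℝ := ‖v‖

/-- The discrete `l²` norm `(h ∑ v_i²)^{1/2}` of a grid function on a mesh of size `h`. -/
def normTwo (h : ℝ) {n : ℕ} (v : Fin n → ℝ) : ℝ := √(h * ∑ i, v i ^ 2)

end FracScheme

end

noncomputable section

/-! Put `p = 1 - 2s` and `κ = fracConst (s - 1)`. Formally `(-Δ)^s u = -(κ|·|^p * u)''`, and the
scheme replaces the second derivative by a central difference and `u` by its piecewise linear
interpolant `v`. On the exact side the Gamma recursion gives `fracConst s = κ p (p - 1)`, so the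
fractional Laplacian is `-κ p (p - 1) / 2` times the integral of `symmDiff2 u x z * |z|^(p-2)`,
absolutely convergent since `symmDiff2` is `O(|z|^(1+α))` with `1 + α > 2s`. On the discrete side
(`modifiedScheme_eq`) the scheme is `-κ` times the convolution of `v` with `rieszKernel`, the second
difference quotient of `|z|^p`, plus a multiple of `(-Δ)_h u`.

The error then has three parts, each `O(M h^(1+α-2s))`. Consistency (`abs_symmetrized_sub_le`):
`rieszKernel` is even with mean zero, so it too can be integrated against `symmDiff2`. The two
kernels differ by `h^(p-2) * rieszRem p (z/h)`; `rieszRem` is integrable against `|t|^(1+α)`, and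
scaling gives `h^(p-1+1+α)`. Interpolation: `|u - v| ≤ M h^(1+α)` everywhere, and the `L¹` norm of
the kernel is a constant times `h^(p-1) = h^(-2s)`. Modification: `ω̄_0` is `O(h^(2-2s))` and
`(-Δ)_h u` is `O(M h^(α-1))`, whatever the sign of `w_1`.

The discrete `l²` bound follows from the uniform one, as the grid has total length at most `2L`. -/

/-! ### Second differences of `|t|^p` and their decay -/

/-- The second central difference of step one of `|t|^p`. -/
def rieszDiff (p t : ℝ) : ℝ := |t - 1| ^ p - 2 * |t| ^ p + |t + 1| ^ p

/-- The difference between the second derivative of `|t|^p` and its second central difference. -/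
def rieszRem (p t : ℝ) : ℝ := p * (p - 1) * |t| ^ (p - 2) - rieszDiff p t

theorem measurable_rieszDiff (p : ℝ) : Measurable (rieszDiff p) := by
  unfold rieszDiff; fun_prop

theorem measurable_rieszRem (p : ℝ) : Measurable (rieszRem p) := by
  unfold rieszRem
  have := measurable_rieszDiff p
  fun_prop

theorem rieszDiff_neg (p t : ℝ) : rieszDiff p (-t) = rieszDiff p t := by
  unfold rieszDiff
  rw [show -t - 1 = -(t + 1) by ring, show -t + 1 = -(t - 1) by ring, abs_neg, abs_neg, abs_neg]
  ring

theorem rieszRem_neg (p t : ℝ) : rieszRem p (-t) = rieszRem p t := by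
  rw [rieszRem, rieszRem, rieszDiff_neg, abs_neg]

/-- Taylor expansion of `(1 + x)^p` to third order. -/
theorem exists_abs_one_add_rpow_sub_le (p : ℝ) : ∃ a C : ℝ, 0 < C ∧ ∀ x : ℝ, |x| ≤ 1 / 2 →
    |(1 + x) ^ p - (1 + p * x + p * (p - 1) / 2 * x ^ 2 + a * x ^ 3)| ≤ C * x ^ 4 := by
  obtain ⟨b, hb, C, hC, h⟩ :=
    (Real.one_add_rpow_hasFPowerSeriesOnBall_zero (a := p)).uniform_geometric_approx'
      (r' := 3 / 4) (by
        rw [← ENNReal.coe_one, ENNReal.coe_lt_coe, ← NNReal.coe_lt_coe]; norm_num)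
  -- The factor `4 / 3` is `1 / r'` for the radius `r' = 3 / 4`, chosen between `1 / 2` and the
  -- radius of convergence. The cubic coefficient is never needed explicitly, because it cancels in
  -- symmetric sums.
  refine ⟨Ring.choose p 3, C * (b * (4 / 3)) ^ 4, by have := hb.1; positivity, fun x hx => ?_⟩
  have := h x (by simp; linarith) 4
  have h2 : Ring.choose p 2 = p * (p - 1) / 2 := by
    have := Ring.descPochhammer_eq_factorial_smul_choose p 2
    simp [descPochhammer_succ_right, Polynomial.smeval_mul, Polynomial.smeval_sub] at this
    linarith
  simp only [FormalMultilinearSeries.partialSum, Finset.sum_range_succ, Finset.sum_range_zero,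
    binomialSeries_apply, h2] at this
  simp at this
  convert this using 1
  · congr 1
    ring
  · have hx4 : |x| ^ 4 = x ^ 4 := (show Even 4 by decide).pow_abs x
    rw [mul_pow, mul_pow, div_pow |x|, hx4]
    ring

/-- Factor out `|t|^p` and expand `(1 ± 1/t)^p`: odd powers of `1/t` cancel in the sum and the
quadratic terms reproduce `p (p - 1) |t|^(p-2)`, so only fourth-order terms survive. -/
theorem exists_abs_rieszRem_le (p : ℝ) :
    ∃ C : ℝ, 0 < C ∧ ∀ t : ℝ, 2 ≤ |t| → |rieszRem p t| ≤ C * |t| ^ (p - 4) := by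
  obtain ⟨a, C, hC, h⟩ := exists_abs_one_add_rpow_sub_le p
  refine ⟨2 * C, by positivity, ?_⟩
  have key : ∀ t : ℝ, 2 ≤ t → |rieszRem p t| ≤ 2 * C * t ^ (p - 4) := by
    intro t ht
    have ht0 : 0 < t := by linarith
    have he : |1 / t| ≤ 1 / 2 := by
      rw [abs_of_pos (by positivity)]
      exact one_div_le_one_div_of_le (by norm_num) ht
    have h1 := h (1 / t) he
    have h2 := h (-(1 / t)) (by rwa [abs_neg])
    have e1 : |t - 1| ^ p = t ^ p * (1 + -(1 / t)) ^ p := by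
      rw [abs_of_pos (by linarith), ← Real.mul_rpow ht0.le]
      · congr 1; field_simp; ring
      · have := (abs_le.1 he).2; linarith
    have e2 : |t + 1| ^ p = t ^ p * (1 + 1 / t) ^ p := by
      rw [abs_of_pos (by linarith), ← Real.mul_rpow ht0.le (by positivity)]
      congr 1; field_simp
    have e3 : t ^ (p - 2) = t ^ p * (1 / t) ^ 2 := by
      rw [Real.rpow_sub ht0, Real.rpow_ofNat]; field_simp
    have e4 : t ^ (p - 4) = t ^ p * (1 / t) ^ 4 := by
      rw [Real.rpow_sub ht0, Real.rpow_ofNat]; field_simp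
    rw [rieszRem, rieszDiff, e1, e2, abs_of_pos ht0, e3, e4]
    set x := 1 / t
    have hb := abs_le.1 (abs_add_le ((1 + x) ^ p - (1 + p * x + p * (p - 1) / 2 * x ^ 2 + a * x ^ 3))
      ((1 + -x) ^ p - (1 + p * -x + p * (p - 1) / 2 * (-x) ^ 2 + a * (-x) ^ 3)))
    rw [show p * (p - 1) * (t ^ p * x ^ 2) -
        (t ^ p * (1 + -x) ^ p - 2 * t ^ p + t ^ p * (1 + x) ^ p) =
        -(t ^ p * (((1 + x) ^ p - (1 + p * x + p * (p - 1) / 2 * x ^ 2 + a * x ^ 3)) +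
        ((1 + -x) ^ p - (1 + p * -x + p * (p - 1) / 2 * (-x) ^ 2 + a * (-x) ^ 3)))) by ring,
      abs_neg, abs_mul, abs_of_pos (Real.rpow_pos_of_pos ht0 p)]
    rw [show 2 * C * (t ^ p * x ^ 4) = t ^ p * (C * x ^ 4 + C * (-x) ^ 4) by ring]
    have := Real.rpow_pos_of_pos ht0 p
    gcongr
    exact (abs_add_le _ _).trans (add_le_add h1 h2)
  intro t ht
  rcases abs_choice t with h0 | h0
  · have := key |t| ht
    rwa [h0] at this ⊢
  · have := key |t| ht
    rwa [h0, rieszRem_neg, ← h0] at this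

theorem exists_abs_rieszDiff_le (p : ℝ) :
    ∃ C : ℝ, 0 < C ∧ ∀ t : ℝ, 2 ≤ |t| → |rieszDiff p t| ≤ C * |t| ^ (p - 2) := by
  obtain ⟨C, hC, h⟩ := exists_abs_rieszRem_le p
  refine ⟨|p * (p - 1)| + C, by positivity, fun t ht => ?_⟩
  have h1 := h t ht
  have h2 : |t| ^ (p - 4) ≤ |t| ^ (p - 2) :=
    Real.rpow_le_rpow_of_exponent_le (by linarith) (by linarith)
  rw [show rieszDiff p t = p * (p - 1) * |t| ^ (p - 2) - rieszRem p t by rw [rieszRem]; ring]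
  refine (abs_sub _ _).trans ?_
  rw [abs_mul, abs_of_nonneg (Real.rpow_nonneg (abs_nonneg t) (p - 2)), add_mul]
  nlinarith

/-! ### Integrability of the difference kernels -/

theorem locallyIntegrable_abs_rpow {r : ℝ} (hr : -1 < r) :
    LocallyIntegrable (fun t : ℝ => |t| ^ r) := by
  refine locallyIntegrable_of_norm_le_rpow (C := 1) (α := -r) (by simp) (by simp; linarith)
    (ae_of_all _ fun x => ?_)
    (by have : Measurable fun t : ℝ => |t| ^ r := by fun_prop
        exact this.aestronglyMeasurable)
  rw [neg_neg, one_mul, Real.norm_eq_abs, Real.norm_eq_abs,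
    abs_of_nonneg (Real.rpow_nonneg (abs_nonneg x) r)]

theorem integrableOn_abs_rpow {r : ℝ} (hr : -1 < r) (c R : ℝ) :
    IntegrableOn (fun t : ℝ => |t - c| ^ r) (Icc (-R) R) := by
  have h := (locallyIntegrable_abs_rpow hr).integrableOn_isCompact
    (isCompact_Icc (a := -R - c) (b := R - c))
  rw [← integrable_indicator_iff measurableSet_Icc] at h ⊢
  refine (h.comp_sub_right c).congr (ae_of_all _ fun t => ?_)
  simp only [indicator, mem_Icc]
  congr 1
  simp

theorem integrable_of_abs_le_rpow {f : ℝ → ℝ} {C r : ℝ} (hf : AEStronglyMeasurable f)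
    (h0 : IntegrableOn f (Icc (-2) 2)) (hr : r < -1)
    (h : ∀ᵐ t, 2 ≤ |t| → |f t| ≤ C * |t| ^ r) : Integrable f := by
  have hp : ∀ {g : ℝ → ℝ}, AEStronglyMeasurable g → (∀ᵐ t, 2 ≤ |t| → |g t| ≤ C * |t| ^ r) →
      IntegrableOn g (Ioi 2) := by
    intro g hg h
    refine Integrable.mono' (g := fun t => C * t ^ r)
      ((integrableOn_Ioi_rpow_of_lt hr (by norm_num)).const_mul C) hg.restrict ?_
    filter_upwards [ae_restrict_mem measurableSet_Ioi, ae_restrict_of_ae h] with t ht h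
    have ht : 2 < t := ht
    have := h (by rw [abs_of_pos (by linarith)]; linarith)
    rwa [abs_of_pos (show 0 < t by linarith)] at this
  have h2 := (hp (hf.comp_quasiMeasurePreserving
    (Measure.measurePreserving_neg volume).quasiMeasurePreserving)
    (by
      filter_upwards [(Measure.measurePreserving_neg volume).quasiMeasurePreserving.ae h] with t h ht
      simpa using h (by simpa using ht)))
  have h3 : IntegrableOn f (Iio (-2)) := by
    rw [← integrable_indicator_iff measurableSet_Ioi] at h2
    rw [← integrable_indicator_iff measurableSet_Iio]
    refine h2.comp_neg.congr (ae_of_all _ fun t => ?_)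
    simp only [indicator, mem_Ioi, mem_Iio, lt_neg, Function.comp, neg_neg]
  have : Iio (-2 : ℝ) ∪ Icc (-2) 2 ∪ Ioi 2 = univ := by
    ext t; simp only [mem_union, mem_Iio, mem_Icc, mem_Ioi, mem_univ, iff_true]; grind
  rw [← integrableOn_univ, ← this]
  exact (h3.union h0).union (hp hf h)

theorem integrableOn_rieszDiff {p : ℝ} (hp : -1 < p) (R : ℝ) :
    IntegrableOn (rieszDiff p) (Icc (-R) R) := by
  have h1 := integrableOn_abs_rpow hp 1 R
  have h2 := integrableOn_abs_rpow hp 0 R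
  have h3 := integrableOn_abs_rpow hp (-1) R
  simp only [sub_zero, sub_neg_eq_add] at h2 h3
  exact (h1.sub (h2.const_mul 2)).add h3

theorem integrable_rieszDiff {p : ℝ} (hp : -1 < p) (hp1 : p < 1) : Integrable (rieszDiff p) := by
  obtain ⟨C, -, h⟩ := exists_abs_rieszDiff_le p
  exact integrable_of_abs_le_rpow (measurable_rieszDiff p).aestronglyMeasurable
    (integrableOn_rieszDiff hp 2) (by linarith) (ae_of_all _ h)

/-- The conditions on `β` are those at the two ends: the singularity `|t|^(p-2+β)` at the origin
needs `β > 1 - p`, the tail `|t|^(p-4+β)` needs `β < 3 - p`. -/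
theorem integrable_rieszRem_mul {p β : ℝ} (hp : -1 < p) (hβ : 0 ≤ β) (h1 : 1 - p < β)
    (h2 : β < 3 - p) : Integrable fun t => rieszRem p t * |t| ^ β := by
  obtain ⟨C, -, h⟩ := exists_abs_rieszRem_le p
  refine integrable_of_abs_le_rpow (C := C) (r := p - 4 + β)
    ((measurable_rieszRem p).mul (by fun_prop)).aestronglyMeasurable ?_ (by linarith)
    (ae_of_all _ ?_)
  · have hI := integrableOn_abs_rpow (show -1 < p - 2 + β by linarith) 0 2
    have hJ : IntegrableOn (fun t => rieszDiff p t * |t| ^ β) (Icc (-2) 2) :=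
      (integrableOn_rieszDiff hp 2).mul_continuousOn
        ((continuous_abs.rpow_const fun _ => Or.inr hβ).continuousOn) isCompact_Icc
    refine ((hI.const_mul (p * (p - 1))).sub hJ).congr ?_
    -- Splitting `|t|^(p-2+β)` into a product may fail at `t = 0`, a null set.
    have : ∀ᵐ t : ℝ ∂(volume.restrict (Icc (-2) 2)), t ≠ 0 :=
      ae_restrict_of_ae (Measure.ae_ne volume 0)
    filter_upwards [this] with t ht
    simp only [Pi.sub_apply, sub_zero, rieszRem]
    rw [Real.rpow_add (abs_pos.2 ht)]
    ring
  · intro t ht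
    rw [Real.rpow_add (by linarith), abs_mul, ← mul_assoc,
      abs_of_nonneg (Real.rpow_nonneg (abs_nonneg t) β)]
    gcongr
    exact h t ht

/-! ### The difference kernel has mean zero -/

theorem integral_abs_rpow {p b : ℝ} (hp : -1 < p) (hb : 0 ≤ b) :
    ∫ t in (0 : ℝ)..b, |t| ^ p = b ^ (p + 1) / (p + 1) := by
  have h : ∫ t in (0 : ℝ)..b, |t| ^ p = ∫ t in (0 : ℝ)..b, t ^ p := by
    apply intervalIntegral.integral_congr
    intro t ht
    rw [uIcc_of_le hb] at ht
    simp only [abs_of_nonneg ht.1]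
  rw [h, integral_rpow (Or.inl hp), Real.zero_rpow (by linarith), sub_zero]

theorem intervalIntegrable_abs_rpow {p : ℝ} (hp : -1 < p) (a b : ℝ) :
    IntervalIntegrable (fun t : ℝ => |t| ^ p) volume a b :=
  ((locallyIntegrable_abs_rpow hp).integrableOn_isCompact isCompact_uIcc).intervalIntegrable

/-- The antiderivative of `|t|^p` is odd, so the contributions `±1 / (p + 1)` of the shifts at the
lower endpoint cancel. -/
theorem integral_rieszDiff_Icc {p R : ℝ} (hp : -1 < p) (hR : 1 ≤ R) :
    ∫ t in (0 : ℝ)..R, rieszDiff p t = rieszDiff (p + 1) R / (p + 1) := by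
  have hI := intervalIntegrable_abs_rpow hp
  have h1 : ∫ t in (0 : ℝ)..R, |t - 1| ^ p = 1 / (p + 1) + (R - 1) ^ (p + 1) / (p + 1) := by
    rw [intervalIntegral.integral_comp_sub_right (fun t => |t| ^ p) 1,
      ← intervalIntegral.integral_add_adjacent_intervals (hI _ 0) (hI _ _),
      integral_abs_rpow hp (by linarith)]
    have := intervalIntegral.integral_comp_neg (fun t : ℝ => |t| ^ p) (a := 0) (b := 1)
    simp only [abs_neg, neg_zero] at this
    rw [zero_sub, ← this, integral_abs_rpow hp zero_le_one, Real.one_rpow]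
  have h2 : ∫ t in (0 : ℝ)..R, |t + 1| ^ p = (R + 1) ^ (p + 1) / (p + 1) - 1 / (p + 1) := by
    rw [intervalIntegral.integral_comp_add_right (fun t => |t| ^ p) 1,
      ← intervalIntegral.integral_interval_sub_left (hI 0 _) (hI 0 _),
      integral_abs_rpow hp (by linarith), integral_abs_rpow hp (by linarith)]
    simp
  have i1 : IntervalIntegrable (fun t : ℝ => |t - 1| ^ p) volume 0 R := by
    simpa using (hI (0 - 1) (R - 1)).comp_sub_right 1
  have i2 : IntervalIntegrable (fun t : ℝ => |t + 1| ^ p) volume 0 R := by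
    simpa using (hI (0 + 1) (R + 1)).comp_add_right 1
  unfold rieszDiff
  rw [intervalIntegral.integral_add (i1.sub ((hI _ _).const_mul 2)) i2,
    intervalIntegral.integral_sub i1 ((hI _ _).const_mul 2), intervalIntegral.integral_const_mul,
    h1, h2, integral_abs_rpow hp (by linarith), abs_of_nonneg (by linarith : 0 ≤ R - 1),
    abs_of_nonneg (by linarith : 0 ≤ R), abs_of_nonneg (by linarith : 0 ≤ R + 1)]
  ring

/-- By evenness it suffices to integrate over the half-line, where the primitive is a second
difference with exponent `p + 1`, hence `O(R^(p-1))`, which tends to zero. This is what allows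
`u(x)` to be subtracted under the convolution. -/
theorem integral_rieszDiff {p : ℝ} (hp : -1 < p) (hp1 : p < 1) : ∫ t, rieszDiff p t = 0 := by
  have habs : ∀ t, rieszDiff p |t| = rieszDiff p t := by
    intro t
    rcases abs_choice t with h | h <;> rw [h]
    exact rieszDiff_neg p t
  have h1 := integral_comp_abs (f := rieszDiff p)
  simp only [habs] at h1
  rw [h1]
  have h2 := intervalIntegral_tendsto_integral_Ioi 0
    (integrable_rieszDiff hp hp1).integrableOn tendsto_id
  obtain ⟨C, -, hC⟩ := exists_abs_rieszDiff_le (p + 1)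
  have h3 : Tendsto (fun R : ℝ => C * R ^ (p - 1)) atTop (𝓝 0) := by
    have := (tendsto_rpow_neg_atTop (show 0 < 1 - p by linarith)).const_mul C
    simpa using this
  have h4 : Tendsto (fun R : ℝ => rieszDiff (p + 1) R) atTop (𝓝 0) := by
    refine squeeze_zero_norm' ?_ h3
    filter_upwards [eventually_ge_atTop 2] with R hR
    have := hC R (by rwa [abs_of_nonneg (by linarith)])
    rwa [abs_of_nonneg (show 0 ≤ R by linarith), show p + 1 - 2 = p - 1 by ring] at this
  have h5 : Tendsto (fun R : ℝ => ∫ t in (0 : ℝ)..R, rieszDiff p t) atTop (𝓝 0) := by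
    have := h4.div_const (p + 1)
    rw [zero_div] at this
    refine this.congr' ?_
    filter_upwards [eventually_ge_atTop 1] with R hR
    exact (integral_rieszDiff_Icc hp hR).symm
  rw [tendsto_nhds_unique h2 h5, mul_zero]


/-! ### The symmetrized fractional Laplacian -/

/-- With `p = 1 - 2s` the factor is `p (p - 1)`, the one produced by differentiating `|z|^p` twice.
It comes from `Γ(a + 1) = a Γ(a)` at `a = s - 1/2`, which must be nonzero, and at `a = 1 - s`. -/
theorem fracConst_eq_mul_fracConst_sub_one {s : ℝ} (hs0 : 0 < s) (hs1 : s < 1) (hs : s ≠ 1 / 2) :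
    fracConst s = fracConst (s - 1) * ((1 - 2 * s) * (-(2 * s))) := by
  have h1 : Real.Gamma (1 / 2 + s) = (s - 1 / 2) * Real.Gamma (s - 1 / 2) := by
    rw [← Real.Gamma_add_one (sub_ne_zero.2 hs)]; congr 1; ring
  have h2 : Real.Gamma (1 - (s - 1)) = (1 - s) * Real.Gamma (1 - s) := by
    rw [← Real.Gamma_add_one (by linarith)]; congr 1; ring
  have h3 : (2 : ℝ) ^ (2 * s) = 2 ^ (2 * (s - 1)) * 4 := by
    rw [show 2 * s = 2 * (s - 1) + 2 by ring, Real.rpow_add (by norm_num)]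
    norm_num
  have h4 : Real.Gamma (1 - s) ≠ 0 := (Real.Gamma_pos_of_pos (by linarith)).ne'
  have h5 : (1 - s) ≠ 0 := by linarith
  unfold fracConst
  rw [abs_of_pos hs0, abs_of_neg (by linarith : s - 1 < 0), h1, h2, h3,
    show 1 / 2 + (s - 1) = s - 1 / 2 by ring]
  field_simp
  ring

/-- The symmetric second difference `u(x + z) + u(x - z) - 2 u(x)`. -/
def symmDiff2 (u : ℝ → ℝ) (x z : ℝ) : ℝ := u (x + z) + u (x - z) - 2 * u x

theorem aestronglyMeasurable_comp_add_left {u : ℝ → ℝ} (hu : AEStronglyMeasurable u) (x : ℝ) :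
    AEStronglyMeasurable fun z => u (x + z) :=
  hu.comp_quasiMeasurePreserving (measurePreserving_add_left volume x).quasiMeasurePreserving

theorem aestronglyMeasurable_comp_sub_left {u : ℝ → ℝ} (hu : AEStronglyMeasurable u) (x : ℝ) :
    AEStronglyMeasurable fun z => u (x - z) :=
  hu.comp_quasiMeasurePreserving (Measure.measurePreserving_sub_left volume x).quasiMeasurePreserving

theorem aestronglyMeasurable_symmDiff2 {u : ℝ → ℝ} (hu : AEStronglyMeasurable u) (x : ℝ) :
    AEStronglyMeasurable (symmDiff2 u x) :=
  ((aestronglyMeasurable_comp_add_left hu x).add (aestronglyMeasurable_comp_sub_left hu x)).sub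
    aestronglyMeasurable_const

theorem ae_comp_add_left {P : ℝ → Prop} (h : ∀ᵐ y : ℝ, P y) (x : ℝ) : ∀ᵐ z : ℝ, P (x + z) :=
  (measurePreserving_add_left volume x).quasiMeasurePreserving.ae h

theorem ae_comp_sub_left {P : ℝ → Prop} (h : ∀ᵐ y : ℝ, P y) (x : ℝ) : ∀ᵐ z : ℝ, P (x - z) :=
  (Measure.measurePreserving_sub_left volume x).quasiMeasurePreserving.ae h

theorem ae_abs_symmDiff2_le {u : ℝ → ℝ} {B : ℝ} (hB : ∀ᵐ y, |u y| ≤ B) (x : ℝ) :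
    ∀ᵐ z, |symmDiff2 u x z| ≤ 2 * B + 2 * |u x| := by
  filter_upwards [ae_comp_add_left hB x, ae_comp_sub_left hB x] with z h1 h2
  unfold symmDiff2
  have := abs_le.1 h1
  have := abs_le.1 h2
  have := abs_le.1 (le_refl |u x|)
  rw [abs_le]; constructor <;> linarith

theorem aestronglyMeasurable_abs_rpow (r : ℝ) : AEStronglyMeasurable fun z : ℝ => |z| ^ r := by
  have : Measurable fun t : ℝ => |t| ^ r := by fun_prop
  exact this.aestronglyMeasurable

theorem integrable_symmDiff2_mul {u : ℝ → ℝ} {x r β A B : ℝ} (hu : AEStronglyMeasurable u)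
    (hB : ∀ᵐ y, |u y| ≤ B) (hA : ∀ᵐ z, |symmDiff2 u x z| ≤ A * |z| ^ β)
    (hr : r < -1) (hrβ : -1 < β + r) :
    Integrable fun z => symmDiff2 u x z * |z| ^ r := by
  have hm := (aestronglyMeasurable_symmDiff2 hu x).mul (aestronglyMeasurable_abs_rpow r)
  refine integrable_of_abs_le_rpow (C := 2 * B + 2 * |u x|) hm ?_ hr ?_
  · have hI := (integrableOn_abs_rpow hrβ 0 2).const_mul A
    refine Integrable.mono' hI hm.restrict (ae_restrict_of_ae ?_)
    filter_upwards [hA, Measure.ae_ne volume 0] with z hz hz0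
    rw [sub_zero, Real.rpow_add (abs_pos.2 hz0), Real.norm_eq_abs, abs_mul, ← mul_assoc,
      abs_of_nonneg (Real.rpow_nonneg (abs_nonneg z) r)]
    gcongr
  · filter_upwards [ae_abs_symmDiff2_le hB x] with z hz _
    rw [abs_mul, abs_of_nonneg (Real.rpow_nonneg (abs_nonneg z) r)]
    gcongr

theorem integrable_indicator_abs_rpow {r ε : ℝ} (hr : r < -1) (hε : 0 < ε) :
    Integrable ({z : ℝ | ε < |z|}.indicator fun z => |z| ^ r) := by
  have hS : MeasurableSet {z : ℝ | ε < |z|} := measurableSet_lt (by fun_prop) (by fun_prop)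
  have hm := (aestronglyMeasurable_abs_rpow r).indicator hS
  refine integrable_of_abs_le_rpow (C := 1) hm ?_ hr (ae_of_all _ fun t _ => ?_)
  · refine Measure.integrableOn_of_bounded (M := ε ^ r) (by simp) hm (ae_of_all _ fun z => ?_)
    by_cases hz : ε < |z|
    · rw [indicator_of_mem (by exact hz), Real.norm_eq_abs,
        abs_of_nonneg (Real.rpow_nonneg (abs_nonneg z) r)]
      exact Real.rpow_le_rpow_of_nonpos hε hz.le (by linarith)
    · rw [indicator_of_notMem (by exact hz), norm_zero]
      positivity
  · rw [one_mul]
    by_cases hz : ε < |t|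
    · rw [indicator_of_mem (by exact hz), abs_of_nonneg (Real.rpow_nonneg (abs_nonneg t) r)]
    · rw [indicator_of_notMem (by exact hz), abs_zero]
      positivity

/-- A bounded function whose symmetric second difference at `x` has order `β > 2s` has a fractional
Laplacian at `x`, given by the absolutely convergent symmetrized integral. -/
theorem hasFracLap_of_symmDiff2_le {u : ℝ → ℝ} {s x β A B : ℝ} (hs0 : 0 < s)
    (hu : AEStronglyMeasurable u) (hB : ∀ᵐ y, |u y| ≤ B)
    (hA : ∀ᵐ z, |symmDiff2 u x z| ≤ A * |z| ^ β) (hβ : 2 * s < β) :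
    HasFracLap s u x (-(fracConst s / 2) * ∫ z, symmDiff2 u x z * |z| ^ (-(1 + 2 * s))) := by
  have hr : -(1 + 2 * s) < -1 := by linarith
  have hS : ∀ ε : ℝ, MeasurableSet {z : ℝ | ε < |z|} := fun ε =>
    measurableSet_lt (by fun_prop) (by fun_prop)
  have hSx : ∀ ε : ℝ, MeasurableSet {y : ℝ | ε < |x - y|} := fun ε =>
    measurableSet_lt (by fun_prop) (by fun_prop)
  -- The truncated integrand in the variable `z = x - y`.
  set F : ℝ → ℝ → ℝ := fun ε =>
    {z : ℝ | ε < |z|}.indicator fun z => (u x - u (x - z)) * |z| ^ (-(1 + 2 * s)) with hF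
  have hFx : ∀ ε y, F ε (x - y) = {y : ℝ | ε < |x - y|}.indicator
      (fun y => (u x - u y) / |x - y| ^ (1 + 2 * s)) y := by
    intro ε y
    simp only [hF, indicator, mem_ofPred_eq, sub_sub_cancel, Real.rpow_neg (abs_nonneg _),
      div_eq_mul_inv]
  have hFi : ∀ ε, 0 < ε → Integrable (F ε) := by
    intro ε hε
    refine Integrable.mono' ((integrable_indicator_abs_rpow hr hε).const_mul (|u x| + B))
      (((aestronglyMeasurable_const.sub (aestronglyMeasurable_comp_sub_left hu x)).mul
        (aestronglyMeasurable_abs_rpow _)).indicator (hS ε)) ?_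
    filter_upwards [ae_comp_sub_left hB x] with z hz
    by_cases h : ε < |z|
    · rw [hF]
      simp only
      rw [indicator_of_mem (by exact h), indicator_of_mem (by exact h), Real.norm_eq_abs, abs_mul,
        abs_of_nonneg (Real.rpow_nonneg (abs_nonneg z) _)]
      gcongr
      exact (abs_sub _ _).trans (by gcongr)
    · rw [hF]
      simp only
      rw [indicator_of_notMem (by exact h), indicator_of_notMem (by exact h)]
      simp
  have hT : ∀ ε, 0 < ε → truncFracLap s u x ε = -(fracConst s / 2) *
      ∫ z, {z : ℝ | ε < |z|}.indicator
        (fun z => symmDiff2 u x z * |z| ^ (-(1 + 2 * s))) z := by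
    intro ε hε
    have e1 : ∫ y in {y : ℝ | ε < |x - y|}, (u x - u y) / |x - y| ^ (1 + 2 * s) = ∫ z, F ε z := by
      rw [← integral_indicator (hSx ε), ← integral_sub_left_eq_self (F ε) volume x]
      simp only [hFx]
    -- Away from the singularity everything converges absolutely, so the integral may be averaged
    -- with its reflection; this produces `symmDiff2`.
    have e2 : ∫ z, F ε z = (∫ z, F ε z + F ε (-z)) / 2 := by
      rw [integral_add (hFi ε hε) (hFi ε hε).comp_neg, integral_neg_eq_self (F ε) volume]
      ring
    rw [truncFracLap, e1, e2, neg_mul, ← mul_neg, ← integral_neg, mul_div_assoc', div_mul_eq_mul_div]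
    congr 3
    ext z
    simp only [hF, indicator, mem_ofPred_eq, abs_neg, sub_neg_eq_add, symmDiff2]
    split_ifs <;> ring
  refine ⟨fun ε hε => ?_, ?_⟩
  · rw [← integrable_indicator_iff (hSx ε)]
    refine ((hFi ε hε).comp_sub_left x).congr (ae_of_all _ fun y => hFx ε y)
  · have hI := integrable_symmDiff2_mul hu hB hA hr (by linarith)
    refine Tendsto.congr' (f₁ := fun ε => -(fracConst s / 2) *
      ∫ z, {z : ℝ | ε < |z|}.indicator
        (fun z => symmDiff2 u x z * |z| ^ (-(1 + 2 * s))) z) ?_ ?_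
    · filter_upwards [self_mem_nhdsWithin] with ε hε using (hT ε hε).symm
    · refine Tendsto.const_mul _ ?_
      -- After symmetrization the untruncated integrand is integrable and dominates every
      -- truncation.
      refine tendsto_integral_filter_of_dominated_convergence _
        (Eventually.of_forall fun ε => hI.1.indicator (hS ε))
        (Eventually.of_forall fun ε => ae_of_all _ fun z => norm_indicator_le_norm_self _ z)
        hI.norm ?_
      filter_upwards [Measure.ae_ne volume 0] with z hz
      refine tendsto_const_nhds.congr' ?_
      filter_upwards [nhdsWithin_le_nhds (eventually_lt_nhds (abs_pos.2 hz))] with ε hε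
      rw [indicator_of_mem (by exact hε)]

theorem HasFracLap.fracLap_eq {s x l : ℝ} {u : ℝ → ℝ} (h : HasFracLap s u x l) :
    fracLap s u x = l := h.tendsto.limUnder_eq

/-! ### The rescaled kernel and consistency -/

/-- The second central difference quotient of step `h` of `|z|^p`. -/
def rieszKernel (p h z : ℝ) : ℝ := h ^ (p - 2) * rieszDiff p (z / h)

theorem rieszKernel_eq {p h : ℝ} (hh : 0 < h) (z : ℝ) :
    rieszKernel p h z = (|z - h| ^ p - 2 * |z| ^ p + |z + h| ^ p) / h ^ 2 := by
  have e : ∀ w : ℝ, |w / h| ^ p = |w| ^ p / h ^ p := fun w => by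
    rw [abs_div, abs_of_pos hh, Real.div_rpow (abs_nonneg w) hh.le]
  have h0 := (Real.rpow_pos_of_pos hh p).ne'
  rw [rieszKernel, rieszDiff, show z / h - 1 = (z - h) / h by field_simp,
    show z / h + 1 = (z + h) / h by field_simp, e, e, e, Real.rpow_sub hh, Real.rpow_ofNat]
  field_simp

theorem integrable_rieszKernel {p h : ℝ} (hp : -1 < p) (hp1 : p < 1) (hh : 0 < h) :
    Integrable (rieszKernel p h) :=
  ((integrable_rieszDiff hp hp1).comp_div hh.ne').const_mul _

theorem integral_rieszKernel {p h : ℝ} (hp : -1 < p) (hp1 : p < 1) :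
    ∫ z, rieszKernel p h z = 0 := by
  unfold rieszKernel
  rw [integral_const_mul, Measure.integral_comp_div, integral_rieszDiff hp hp1]
  simp

theorem integral_abs_rieszKernel {p h : ℝ} (hh : 0 < h) :
    ∫ z, |rieszKernel p h z| = h ^ (p - 1) * ∫ t, |rieszDiff p t| := by
  have e : ∀ z, |rieszKernel p h z| = h ^ (p - 2) * |rieszDiff p (z / h)| := fun z => by
    rw [rieszKernel, abs_mul, abs_of_pos (Real.rpow_pos_of_pos hh _)]
  simp only [e]
  rw [integral_const_mul, Measure.integral_comp_div (fun t => |rieszDiff p t|), abs_of_pos hh,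
    smul_eq_mul, ← mul_assoc, ← Real.rpow_add_one hh.ne']
  congr 2; ring

theorem rieszKernel_neg (p h z : ℝ) : rieszKernel p h (-z) = rieszKernel p h z := by
  rw [rieszKernel, rieszKernel, neg_div, rieszDiff_neg]

theorem abs_integral_rieszKernel_mul_le {p h A : ℝ} {f : ℝ → ℝ} (hp : -1 < p) (hp1 : p < 1)
    (hh : 0 < h) (hf : ∀ᵐ y, |f y| ≤ A) (x : ℝ) :
    |∫ y, rieszKernel p h (x - y) * f y| ≤ A * h ^ (p - 1) * ∫ t, |rieszDiff p t| := by
  have hi := ((integrable_rieszKernel hp hp1 hh).comp_sub_left x).abs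
  calc |∫ y, rieszKernel p h (x - y) * f y| ≤ ∫ y, |rieszKernel p h (x - y)| * A := by
        rw [← Real.norm_eq_abs]
        refine norm_integral_le_of_norm_le (hi.mul_const A) ?_
        filter_upwards [hf] with y hy
        rw [Real.norm_eq_abs, abs_mul]
        gcongr
    _ = A * h ^ (p - 1) * ∫ t, |rieszDiff p t| := by
        rw [integral_mul_const, integral_sub_left_eq_self (fun z => |rieszKernel p h z|) volume x,
          integral_abs_rieszKernel hh]
        ring

theorem integrable_rieszKernel_mul {p h B : ℝ} {u : ℝ → ℝ} (hp : -1 < p) (hp1 : p < 1)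
    (hh : 0 < h) (hu : AEStronglyMeasurable u) (hB : ∀ᵐ y, |u y| ≤ B) :
    Integrable fun z => rieszKernel p h z * u z :=
  (integrable_rieszKernel hp hp1 hh).mul_bdd hu hB

/-- Evenness of the kernel symmetrizes `u`, and its zero mean makes the subtracted constant `2 u(x)`
free. -/
theorem integral_rieszKernel_mul_eq {p h B : ℝ} {u : ℝ → ℝ} (hp : -1 < p) (hp1 : p < 1)
    (hh : 0 < h) (hu : AEStronglyMeasurable u) (hB : ∀ᵐ y, |u y| ≤ B) (x : ℝ) :
    ∫ y, rieszKernel p h (x - y) * u y = (∫ z, symmDiff2 u x z * rieszKernel p h z) / 2 := by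
  have hk := integrable_rieszKernel hp hp1 hh
  have h1 := integrable_rieszKernel_mul hp hp1 hh (aestronglyMeasurable_comp_sub_left hu x)
    (ae_comp_sub_left hB x)
  have h2 := integrable_rieszKernel_mul hp hp1 hh (aestronglyMeasurable_comp_add_left hu x)
    (ae_comp_add_left hB x)
  have e1 : ∫ y, rieszKernel p h (x - y) * u y = ∫ z, rieszKernel p h z * u (x - z) := by
    rw [← integral_sub_left_eq_self (fun z => rieszKernel p h z * u (x - z)) volume x]
    simp
  have e2 : ∫ z, rieszKernel p h z * u (x - z) = ∫ z, rieszKernel p h z * u (x + z) := by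
    rw [← integral_neg_eq_self]
    simp [rieszKernel_neg]
  have e3 : ∫ z, symmDiff2 u x z * rieszKernel p h z =
      (∫ z, rieszKernel p h z * u (x + z)) + (∫ z, rieszKernel p h z * u (x - z))
        - (∫ z, rieszKernel p h z) * (2 * u x) := by
    rw [← integral_add h2 h1, ← integral_mul_const]
    refine Eq.trans ?_ (integral_sub (h2.add h1) (hk.mul_const _))
    congr 1; ext z; simp only [symmDiff2]; ring
  rw [e3, integral_rieszKernel hp hp1, e1, ← e2]
  ring

/-- Consistency of the discretization `(-Δ)_h` of the Riesz potential of `u`. -/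
theorem abs_symmetrized_sub_le {u : ℝ → ℝ} {p h x β A B : ℝ} (hp : -1 < p) (hp1 : p < 1)
    (hh : 0 < h) (hβ : 0 ≤ β) (hβ1 : 1 - p < β) (hβ2 : β < 3 - p) (hu : AEStronglyMeasurable u)
    (hB : ∀ᵐ y, |u y| ≤ B) (hA : ∀ᵐ z, |symmDiff2 u x z| ≤ A * |z| ^ β) :
    |p * (p - 1) / 2 * (∫ z, symmDiff2 u x z * |z| ^ (p - 2))
      - ∫ y, rieszKernel p h (x - y) * u y|
      ≤ A * h ^ (p - 1 + β) * ∫ t, |rieszRem p t * |t| ^ β| := by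
  have h1 := integrable_symmDiff2_mul hu hB hA (r := p - 2) (by linarith) (by linarith)
  have h2 : Integrable fun z => symmDiff2 u x z * rieszKernel p h z :=
    (integrable_rieszKernel hp hp1 hh).bdd_mul (aestronglyMeasurable_symmDiff2 hu x)
      (ae_abs_symmDiff2_le hB x)
  have hR := integrable_rieszRem_mul hp hβ hβ1 hβ2
  have hI0 : 0 ≤ ∫ t, |rieszRem p t * |t| ^ β| := integral_nonneg fun _ => abs_nonneg _
  -- Homogeneity: `|z|^(p-2) = h^(p-2) |z/h|^(p-2)`.
  have e : ∀ z, p * (p - 1) * |z| ^ (p - 2) - rieszKernel p h z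
      = h ^ (p - 2) * rieszRem p (z / h) := by
    intro z
    have := (Real.rpow_pos_of_pos hh (p - 2)).ne'
    rw [rieszKernel, rieszRem, abs_div, abs_of_pos hh, Real.div_rpow (abs_nonneg z) hh.le]
    field_simp
  rw [integral_rieszKernel_mul_eq hp hp1 hh hu hB]
  have e2 : p * (p - 1) / 2 * (∫ z, symmDiff2 u x z * |z| ^ (p - 2))
      - (∫ z, symmDiff2 u x z * rieszKernel p h z) / 2
      = (∫ z, symmDiff2 u x z * (h ^ (p - 2) * rieszRem p (z / h))) / 2 := by
    rw [← integral_const_mul, ← integral_div, ← integral_div, ← integral_sub (h1.const_mul _)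
      (h2.div_const 2)]
    congr 1; ext z
    rw [← e]
    ring
  have e3 : |∫ z, symmDiff2 u x z * (h ^ (p - 2) * rieszRem p (z / h))|
      ≤ ∫ z, A * h ^ (p - 2) * h ^ β * |rieszRem p (z / h) * |z / h| ^ β| := by
    rw [← Real.norm_eq_abs]
    refine norm_integral_le_of_norm_le ((hR.comp_div hh.ne').abs.const_mul _) ?_
    filter_upwards [hA] with z hz
    have hhp := Real.rpow_pos_of_pos hh (p - 2)
    have hb := Real.rpow_pos_of_pos hh β
    rw [Real.norm_eq_abs, abs_mul, abs_mul, abs_mul, abs_of_pos hhp,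
      abs_of_nonneg (Real.rpow_nonneg (abs_nonneg (z / h)) β), abs_div, abs_of_pos hh,
      Real.div_rpow (abs_nonneg z) hh.le]
    calc |symmDiff2 u x z| * (h ^ (p - 2) * |rieszRem p (z / h)|)
        ≤ A * |z| ^ β * (h ^ (p - 2) * |rieszRem p (z / h)|) := by gcongr
      _ = _ := by field_simp
  have e4 : ∫ z, A * h ^ (p - 2) * h ^ β * |rieszRem p (z / h) * |z / h| ^ β|
      = A * h ^ (p - 1 + β) * ∫ t, |rieszRem p t * |t| ^ β| := by
    rw [integral_const_mul, Measure.integral_comp_div (fun t => |rieszRem p t * |t| ^ β|),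
      abs_of_pos hh, smul_eq_mul, show p - 1 + β = (p - 2) + 1 + β by ring,
      Real.rpow_add hh, Real.rpow_add hh, Real.rpow_one]
    ring
  rw [e4] at e3
  rw [e2, abs_div, abs_two]
  linarith [abs_nonneg (∫ z, symmDiff2 u x z * (h ^ (p - 2) * rieszRem p (z / h)))]


/-! ### Consequences of Hölder regularity -/

namespace C1HolderBound

variable {α a b M : ℝ} {u : ℝ → ℝ}

theorem nonneg (h : C1HolderBound α a b M u) (hab : a ≤ b) : 0 ≤ M :=
  (abs_nonneg _).trans (h.abs_le a (left_mem_Icc.2 hab))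

theorem abs_taylor_le (h : C1HolderBound α a b M u) (hM : 0 ≤ M) (hα : 0 < α) {x y : ℝ}
    (hx : x ∈ Icc a b) (hy : y ∈ Icc a b) :
    |u y - u x - derivWithin u (Icc a b) x * (y - x)| ≤ M * |y - x| ^ (1 + α) := by
  have hsub : uIcc x y ⊆ Icc a b := ordConnected_Icc.uIcc_subset hx hy
  -- Mean value inequality for `u` minus its tangent at `x`, whose derivative is at most `M |y -
  -- x|^α` between `x` and `y`.
  have key := (convex_uIcc x y).norm_image_sub_le_of_norm_hasDerivWithin_le
    (f := fun t => u t - derivWithin u (Icc a b) x * t)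
    (f' := fun t => derivWithin u (Icc a b) t - derivWithin u (Icc a b) x)
    (C := M * |y - x| ^ α) (x := x) (y := y) (fun t ht => ?_) (fun t ht => ?_)
    left_mem_uIcc right_mem_uIcc
  · rw [Real.norm_eq_abs, Real.norm_eq_abs, mul_assoc] at key
    rcases eq_or_ne y x with rfl | hne
    · simp [Real.zero_rpow (by linarith : 1 + α ≠ 0)]
    · rw [add_comm, Real.rpow_add_one (abs_pos.2 (sub_ne_zero.2 hne)).ne']
      refine le_trans (le_of_eq ?_) key
      congr 1; ring
  · have := ((h.differentiableOn t (hsub ht)).hasDerivWithinAt.mono hsub).sub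
      ((hasDerivWithinAt_id t (uIcc x y)).const_mul (derivWithin u (Icc a b) x))
    rw [mul_one] at this
    exact this
  · refine (h.holder t (hsub ht) x hx).trans ?_
    exact mul_le_mul_of_nonneg_left (Real.rpow_le_rpow (abs_nonneg _)
      (abs_sub_left_of_mem_uIcc ht) hα.le) hM

theorem abs_symmDiff2_le (h : C1HolderBound α a b M u) (hM : 0 ≤ M) (hα : 0 < α) {x z : ℝ}
    (hx : x ∈ Icc a b) (h1 : x + z ∈ Icc a b) (h2 : x - z ∈ Icc a b) :
    |symmDiff2 u x z| ≤ 2 * M * |z| ^ (1 + α) := by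
  have e1 := _root_.abs_le.1 (h.abs_taylor_le hM hα hx h1)
  have e2 := _root_.abs_le.1 (h.abs_taylor_le hM hα hx h2)
  rw [add_sub_cancel_left] at e1
  rw [sub_sub_cancel_left, abs_neg] at e2
  rw [symmDiff2, _root_.abs_le]
  constructor <;> linarith

/-- For `|z| ≤ δ` both shifted points stay in `[a, b]` and Taylor gives the constant `2`. For `|z| ≥
δ` the trivial bound `4 M` is absorbed by `|z|^(1+α) / δ^(1+α) ≥ 1`. -/
theorem ae_abs_symmDiff2_le {δ x : ℝ} (h : C1HolderBound α a b M u) (hM : 0 ≤ M) (hα : 0 < α)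
    (hδ : 0 < δ) (hu : ∀ᵐ y, |u y| ≤ M) (hx : x ∈ Icc (a + δ) (b - δ)) :
    ∀ᵐ z, |symmDiff2 u x z| ≤ (2 + 4 / δ ^ (1 + α)) * M * |z| ^ (1 + α) := by
  have hx' : x ∈ Icc a b := ⟨by linarith [hx.1], by linarith [hx.2]⟩
  have hδα := Real.rpow_pos_of_pos hδ (1 + α)
  filter_upwards [_root_.ae_abs_symmDiff2_le hu x] with z hz
  have hz0 : 0 ≤ |z| ^ (1 + α) := Real.rpow_nonneg (abs_nonneg z) _
  rcases le_total |z| δ with hzd | hzd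
  · have hz' := _root_.abs_le.1 hzd
    refine (h.abs_symmDiff2_le hM hα hx' ⟨by linarith [hx.1], by linarith [hx.2]⟩
      ⟨by linarith [hx.1], by linarith [hx.2]⟩).trans ?_
    gcongr
    have : 0 ≤ 4 / δ ^ (1 + α) := by positivity
    linarith
  · have h1 : δ ^ (1 + α) ≤ |z| ^ (1 + α) := by gcongr
    have h2 : 1 ≤ |z| ^ (1 + α) / δ ^ (1 + α) := (one_le_div hδα).2 h1
    have h3 := h.abs_le x hx'
    calc |symmDiff2 u x z| ≤ 4 * M := by linarith
      _ ≤ 4 * M * (|z| ^ (1 + α) / δ ^ (1 + α)) := le_mul_of_one_le_right (by positivity) h2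
      _ = 4 / δ ^ (1 + α) * M * |z| ^ (1 + α) := by ring
      _ ≤ _ := by
        gcongr
        linarith

end C1HolderBound

theorem integrable_abs_rpow_sub_mul {p B R : ℝ} {f : ℝ → ℝ} (hp : -1 < p)
    (hf : AEStronglyMeasurable f) (hB : ∀ᵐ y, |f y| ≤ B) (hR : Function.support f ⊆ Icc (-R) R)
    (x : ℝ) : Integrable fun y => |x - y| ^ p * f y := by
  have h1 := integrableOn_abs_rpow hp x R
  have h2 : IntegrableOn (fun y => |x - y| ^ p * f y) (Icc (-R) R) := by
    simp only [abs_sub_comm x]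
    exact h1.mul_bdd hf.restrict (ae_restrict_of_ae hB)
  rwa [integrableOn_iff_integrable_of_support_subset] at h2
  exact (Function.support_mul_subset_right _ _).trans hR

/-! ### Grid, hat functions and interpolation error -/

namespace FracScheme

variable {L : ℝ} {N : ℕ}

theorem mesh_pos (hL : 0 < L) (hN : 0 < N) : 0 < mesh L N := by
  unfold mesh; positivity

theorem mul_mesh (hN : 0 < N) : N * mesh L N = 2 * L := by
  unfold mesh; field_simp

theorem node_add_one (i : ℤ) : node L N (i + 1) = node L N i + mesh L N := by
  unfold node; push_cast; ring

theorem node_sub_one (i : ℤ) : node L N (i - 1) = node L N i - mesh L N := by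
  unfold node; push_cast; ring

theorem node_zero : node L N 0 = -L := by simp [node]

theorem node_self (hN : 0 < N) : node L N N = L := by
  unfold node; push_cast; rw [mul_mesh hN]; ring

theorem node_sub_node (i j : ℤ) : node L N i - node L N j = ((i - j : ℤ) : ℝ) * mesh L N := by
  unfold node; push_cast; ring

theorem node_mono (hL : 0 < L) (hN : 0 < N) : Monotone (node L N) := by
  intro i j hij
  have := mesh_pos hL hN
  unfold node
  gcongr

theorem node_mem_Icc (hL : 0 < L) (hN : 0 < N) {i : ℤ} (h0 : 0 ≤ i) (h1 : i ≤ N) :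
    node L N i ∈ Icc (-L) L := by
  constructor
  · exact node_zero.symm.trans_le (node_mono hL hN h0)
  · exact (node_mono hL hN h1).trans_eq (node_self hN)

theorem exists_mem_Icc_node (hL : 0 < L) (hN : 0 < N) {y : ℝ} (hy : y ∈ Icc (-L) L) :
    ∃ k : ℤ, 0 ≤ k ∧ k + 1 ≤ N ∧ node L N k ≤ y ∧ y ≤ node L N (k + 1) := by
  have hh := mesh_pos hL hN
  -- At `y = L` the floor would give `N`, so the last cell is chosen by hand.
  rcases eq_or_lt_of_le hy.2 with rfl | hlt
  · refine ⟨N - 1, by omega, by omega, (node_mem_Icc hL hN (by omega) (by omega)).2, ?_⟩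
    rw [sub_add_cancel, node_self hN]
  · have h1 := Int.floor_le ((y + L) / mesh L N)
    have h2 := Int.lt_floor_add_one ((y + L) / mesh L N)
    rw [le_div_iff₀ hh] at h1
    rw [div_lt_iff₀ hh] at h2
    refine ⟨⌊(y + L) / mesh L N⌋, Int.floor_nonneg.2 (div_nonneg (by linarith [hy.1]) hh.le), ?_,
      by unfold node; linarith, by rw [node]; push_cast; linarith⟩
    rw [Int.add_one_le_iff, Int.floor_lt, div_lt_iff₀ hh]
    have := mul_mesh (L := L) hN
    push_cast
    linarith

theorem hat_of_le {h t : ℝ} (ht : h ≤ |t|) : hat h t = 0 := by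
  have : t ∉ Ioo (-h) h := fun hm => absurd (abs_lt.2 hm) (not_lt.2 ht)
  exact indicator_of_notMem this _

theorem hat_of_abs_le {h t : ℝ} (hh : 0 < h) (ht : |t| ≤ h) : hat h t = 1 - |t| / h := by
  rcases eq_or_lt_of_le ht with he | hlt
  · rw [hat_of_le he.ge, he, div_self hh.ne', sub_self]
  · have : t ∈ Ioo (-h) h := abs_lt.1 hlt
    exact indicator_of_mem this _

theorem hat_mem_Icc {h : ℝ} (hh : 0 < h) (t : ℝ) : hat h t ∈ Icc (0 : ℝ) 1 := by
  rcases le_total |t| h with ht | ht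
  · rw [hat_of_abs_le hh ht]
    have := (div_le_one hh).2 ht
    constructor
    · linarith
    · have : 0 ≤ |t| / h := by positivity
      linarith
  · rw [hat_of_le ht]; simp

theorem measurable_hat (h : ℝ) : Measurable (hat h) := by
  unfold hat
  exact Measurable.indicator (by fun_prop) measurableSet_Ioo

theorem basisFun_eq_hat {j : ℤ} {y : ℝ} (hy : y ∈ Icc (-L) L) :
    basisFun L N j y = hat (mesh L N) (y - node L N j) := by
  by_cases h : y ∈ Icc (node L N (j - 1)) (node L N (j + 1))
  · exact indicator_of_mem (show y ∈ _ ∩ _ from ⟨h, hy⟩) _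
  · rw [basisFun, indicator_of_notMem (fun hm => h hm.1), hat_of_le]
    rw [node_add_one, node_sub_one, mem_Icc, not_and_or, not_le, not_le] at h
    rcases h with h | h
    · exact le_trans (by linarith) (neg_le_abs _)
    · exact le_trans (by linarith) (le_abs_self _)

theorem basisFun_eq_zero {j : ℤ} {y : ℝ} (hy : y ∉ Icc (-L) L) : basisFun L N j y = 0 :=
  indicator_of_notMem (fun hm => hy hm.2) _

/-- The support of an interior hat lies in `[-L, L]`, so only the two end hats are really truncated.
-/
theorem basisFun_interior (hL : 0 < L) (hN : 0 < N) {j : ℤ} (h0 : 0 < j) (h1 : j < N) (y : ℝ) :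
    basisFun L N j y = hat (mesh L N) (y - node L N j) := by
  by_cases hy : y ∈ Icc (-L) L
  · exact basisFun_eq_hat hy
  · rw [basisFun_eq_zero hy, hat_of_le]
    have e1 := (node_mem_Icc hL hN (i := j - 1) (by omega) (by omega)).1
    have e2 := (node_mem_Icc hL hN (i := j + 1) (by omega) (by omega)).2
    rw [node_sub_one] at e1
    rw [node_add_one] at e2
    rw [mem_Icc, not_and_or, not_le, not_le] at hy
    rcases hy with h | h
    · exact le_trans (by linarith) (neg_le_abs _)
    · exact le_trans (by linarith) (le_abs_self _)

theorem measurable_basisFun (j : ℤ) : Measurable (basisFun L N j) := by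
  unfold basisFun
  exact Measurable.indicator ((measurable_hat _).comp (by fun_prop))
    (measurableSet_Icc.inter measurableSet_Icc)

theorem support_basisFun_subset (j : ℤ) : Function.support (basisFun L N j) ⊆ Icc (-L) L := by
  intro y hy
  by_contra h
  exact hy (basisFun_eq_zero h)

theorem abs_basisFun_le (hL : 0 < L) (hN : 0 < N) (j : ℤ) (y : ℝ) : |basisFun L N j y| ≤ 1 := by
  by_cases hy : y ∈ Icc (-L) L
  · have := hat_mem_Icc (mesh_pos hL hN) (y - node L N j)
    rw [basisFun_eq_hat hy, abs_of_nonneg this.1]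
    exact this.2
  · rw [basisFun_eq_zero hy]; simp

/-- The piecewise linear interpolant of `u` on `[-L, L]`, extended by `g`. -/
def interpolant (L : ℝ) (N : ℕ) (u g : ℝ → ℝ) (y : ℝ) : ℝ :=
  ∑ j ∈ Finset.Icc (0 : ℤ) N, u (node L N j) * basisFun L N j y + g y

theorem sum_basisFun_eq (hL : 0 < L) (hN : 0 < N) {k : ℤ} {y : ℝ} (h0 : 0 ≤ k) (h1 : k + 1 ≤ N)
    (hy0 : node L N k ≤ y) (hy1 : y ≤ node L N (k + 1)) (c : ℤ → ℝ) :
    ∑ j ∈ Finset.Icc (0 : ℤ) N, c j * basisFun L N j y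
      = c k * (1 - (y - node L N k) / mesh L N) + c (k + 1) * ((y - node L N k) / mesh L N) := by
  have hh := mesh_pos hL hN
  have hyI : y ∈ Icc (-L) L :=
    ⟨(node_mem_Icc hL hN h0 (by omega)).1.trans hy0,
      hy1.trans (node_mem_Icc hL hN (by omega) h1).2⟩
  rw [Finset.sum_eq_add k (k + 1) (by omega)]
  · rw [basisFun_eq_hat hyI, basisFun_eq_hat hyI, node_add_one] at *
    rw [hat_of_abs_le hh, hat_of_abs_le hh, abs_of_nonneg (by linarith), abs_of_nonpos (by linarith)]
    · field_simp
      ring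
    · rw [abs_of_nonpos] <;> linarith
    · rw [abs_of_nonneg] <;> linarith
  · intro j _ hj
    rw [basisFun_eq_hat hyI, hat_of_le, mul_zero]
    rcases lt_or_gt_of_ne hj.1 with h | h
    · have := node_mono hL hN (show j + 1 ≤ k by omega)
      rw [node_add_one] at this
      exact le_trans (by linarith) (le_abs_self _)
    · have := node_mono hL hN (show k + 1 ≤ j - 1 by omega)
      rw [node_sub_one] at this
      exact le_trans (by linarith) (neg_le_abs _)
  · intro h; exact absurd (Finset.mem_Icc.2 ⟨h0, by omega⟩) h
  · intro h; exact absurd (Finset.mem_Icc.2 ⟨by omega, h1⟩) h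

/-- Expand both neighbouring nodal values about `y`: the interpolation weights are convex and cancel
the linear terms, leaving a convex combination of Taylor remainders. Outside `[-L, L]` the
interpolant equals `u`. -/
theorem abs_sub_interpolant_le {α a b M : ℝ} {u g : ℝ → ℝ} (hL : 0 < L) (hN : 0 < N) (hα : 0 < α)
    (hM : 0 ≤ M) (hg : ∀ x ∈ Icc (-L) L, g x = 0) (hug : ∀ x, x ∉ Icc (-L) L → u x = g x)
    (hu : C1HolderBound α a b M u) (ha : a ≤ -L) (hb : L ≤ b) (y : ℝ) :
    |u y - interpolant L N u g y| ≤ M * mesh L N ^ (1 + α) := by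
  have hh := mesh_pos hL hN
  by_cases hy : y ∈ Icc (-L) L
  · obtain ⟨k, h0, h1, hy0, hy1⟩ := exists_mem_Icc_node hL hN hy
    rw [interpolant, hg y hy, add_zero,
      sum_basisFun_eq hL hN h0 h1 hy0 hy1 (fun j => u (node L N j))]
    have hsub : Icc (-L) L ⊆ Icc a b := Icc_subset_Icc ha hb
    have hk := hu.abs_taylor_le hM hα (hsub hy) (hsub (node_mem_Icc hL hN h0 (by omega)))
    have hk1 := hu.abs_taylor_le hM hα (hsub hy) (hsub (node_mem_Icc hL hN (by omega) h1))
    rw [node_add_one] at *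
    have b1 : |node L N k - y| ^ (1 + α) ≤ mesh L N ^ (1 + α) := by
      gcongr
      rw [abs_of_nonpos] <;> linarith
    have b2 : |node L N k + mesh L N - y| ^ (1 + α) ≤ mesh L N ^ (1 + α) := by
      gcongr
      rw [abs_of_nonneg] <;> linarith
    have hk' := abs_le.1 (hk.trans (mul_le_mul_of_nonneg_left b1 hM))
    have hk1' := abs_le.1 (hk1.trans (mul_le_mul_of_nonneg_left b2 hM))
    set B := M * mesh L N ^ (1 + α)
    set D := derivWithin u (Icc a b) y
    have ht0 : 0 ≤ (y - node L N k) / mesh L N := div_nonneg (by linarith) hh.le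
    have ht1 : (y - node L N k) / mesh L N ≤ 1 := by rw [div_le_one hh]; linarith
    have hty : y - node L N k = (y - node L N k) / mesh L N * mesh L N := by field_simp
    set t := (y - node L N k) / mesh L N
    have e : u y - (u (node L N k) * (1 - t) + u (node L N k + mesh L N) * t)
        = -((1 - t) * (u (node L N k) - u y - D * (node L N k - y))
          + t * (u (node L N k + mesh L N) - u y - D * (node L N k + mesh L N - y))) := by
      linear_combination D * hty
    rw [e, abs_neg]
    have m1 : 0 ≤ 1 - t := by linarith
    rw [abs_le]
    constructor
    · nlinarith [mul_le_mul_of_nonneg_left hk'.1 m1, mul_le_mul_of_nonneg_left hk1'.1 ht0]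
    · nlinarith [mul_le_mul_of_nonneg_left hk'.2 m1, mul_le_mul_of_nonneg_left hk1'.2 ht0]
  · rw [interpolant, hug y hy, Finset.sum_eq_zero fun j _ => by rw [basisFun_eq_zero hy, mul_zero]]
    simp only [zero_add, sub_self, abs_zero]
    positivity

/-! ### The scheme as a discretized Riesz potential -/

/-- `(-Δ)_h` of the Riesz potential of `f`, written as a convolution with a difference kernel. -/
theorem discNegLap_potential {p c : ℝ} {f : ℝ → ℝ} (hL : 0 < L) (hN : 0 < N)
    (hf : ∀ x, Integrable fun y => |x - y| ^ p * f y) (i : ℤ) :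
    discNegLap (mesh L N) (fun m => c * ∫ y, |node L N m - y| ^ p * f y) i
      = -c * ∫ y, rieszKernel p (mesh L N) (node L N i - y) * f y := by
  have hh := mesh_pos hL hN
  have e : ∀ y, rieszKernel p (mesh L N) (node L N i - y) * f y
      = (|node L N (i - 1) - y| ^ p * f y - 2 * (|node L N i - y| ^ p * f y)
        + |node L N (i + 1) - y| ^ p * f y) / mesh L N ^ 2 := by
    intro y
    rw [rieszKernel_eq hh, node_add_one, node_sub_one, sub_right_comm,
      show node L N i - y + mesh L N = node L N i + mesh L N - y by ring]
    ring
  simp only [e]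
  rw [integral_div, integral_add _ (hf _), integral_sub (hf _) ((hf _).const_mul 2),
    integral_const_mul, discNegLap]
  · ring
  · exact (hf _).sub ((hf _).const_mul 2)

theorem integral_basisFun_interior {s : ℝ} (hL : 0 < L) (hN : 0 < N) {j : ℤ} (h0 : 0 < j)
    (h1 : j < N) (m : ℤ) :
    fracConst (s - 1) * ∫ y, |node L N m - y| ^ (1 - 2 * s) * basisFun L N j y
      = omegaBar s (mesh L N) (j - m) := by
  have hh := mesh_pos hL hN
  have e1 : ∫ y, |node L N m - y| ^ (1 - 2 * s) * basisFun L N j y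
      = ∫ y, |((j - m : ℤ) : ℝ) * mesh L N - y| ^ (1 - 2 * s) * hat (mesh L N) y := by
    -- Substitute `y ↦ x_j - y`; the hat is even.
    rw [← integral_sub_left_eq_self _ volume (node L N j)]
    congr 1; ext y
    rw [basisFun_interior hL hN h0 h1, ← node_sub_node, sub_sub_cancel_left]
    congr 1
    · rw [← abs_neg]; congr 2; ring
    · unfold hat
      simp only [indicator, abs_neg, mem_Ioo]
      congr 1
      simp only [eq_iff_iff]
      constructor <;> rintro ⟨_, _⟩ <;> constructor <;> linarith
  rw [e1, omegaBar, intervalIntegral.integral_of_le (by linarith),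
    setIntegral_eq_integral_of_forall_compl_eq_zero]
  intro y hy
  rw [hat_of_le, mul_zero]
  rw [mem_Ioc, not_and_or, not_lt, not_le] at hy
  rcases hy with h | h
  · exact le_trans (by linarith) (neg_le_abs _)
  · exact le_trans h.le (le_abs_self _)

theorem sum_Icc_eq_interior_add (hN : 0 < N) (f : ℤ → ℝ) :
    ∑ j ∈ Finset.Icc (0 : ℤ) N, f j = ∑ j ∈ Finset.Icc (1 : ℤ) (N - 1), f j + (f 0 + f N) := by
  have h : Finset.Icc (0 : ℤ) N = insert 0 (insert (N : ℤ) (Finset.Icc (1 : ℤ) (N - 1))) := by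
    ext j; simp only [Finset.mem_Icc, Finset.mem_insert]; omega
  rw [h, Finset.sum_insert, Finset.sum_insert]
  · ring
  · simp
  · simp only [Finset.mem_insert, Finset.mem_Icc]; omega

/-- Only the central value of `ω̄` changes, so the weights change by a multiple of `(-Δ)_h` of a
Kronecker delta. -/
theorem weightM_sub_weight (s h : ℝ) (k : ℤ) :
    weightM s h k - weight s h k = (omegaBarM s h 0 - omegaBar s h 0) *
      discNegLap h (fun m => if m = 0 then 1 else 0) k := by
  have e : ∀ m, omegaBarM s h m = omegaBar s h m +
      (omegaBarM s h 0 - omegaBar s h 0) * (if m = 0 then 1 else 0) := by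
    intro m
    by_cases hm : m = 0
    · subst hm; simp
    · simp [omegaBarM, hm]
  simp only [weightM, weight, discNegLap]
  rw [e (k - 1), e k, e (k + 1)]
  ring

/-- The sum must run over all of `0, …, N`: the neighbours `i ± 1` of an interior node may be end
nodes. Thus the end corrections in the scheme complete the modification to a multiple of `(-Δ)_h u`.
-/
theorem sum_discNegLap_single (h : ℝ) {i : ℤ} (h0 : 0 < i) (h1 : i < N) (v : ℤ → ℝ) :
    ∑ j ∈ Finset.Icc (0 : ℤ) N, discNegLap h (fun m => if m = 0 then 1 else 0) (j - i) * v j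
      = discNegLap h v i := by
  have e : ∀ j : ℤ, discNegLap h (fun m => if m = 0 then 1 else 0) (j - i) * v j
      = -((if j = i - 1 then v j else 0) - 2 * (if j = i then v j else 0)
        + (if j = i + 1 then v j else 0)) / h ^ 2 := by
    intro j
    simp only [discNegLap, show j - i - 1 = 0 ↔ j = i + 1 by omega, show j - i = 0 ↔ j = i by omega,
      show j - i + 1 = 0 ↔ j = i - 1 by omega]
    split_ifs <;> ring
  simp only [e]
  rw [← Finset.sum_div, Finset.sum_neg_distrib, Finset.sum_add_distrib, Finset.sum_sub_distrib,
    ← Finset.mul_sum, Finset.sum_ite_eq', Finset.sum_ite_eq', Finset.sum_ite_eq',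
    if_pos (Finset.mem_Icc.2 (by omega)), if_pos (Finset.mem_Icc.2 (by omega)),
    if_pos (Finset.mem_Icc.2 (by omega)), discNegLap]

theorem integrable_abs_rpow_mul_basisFun {p : ℝ} (hp : -1 < p) (hL : 0 < L) (hN : 0 < N) (j : ℤ)
    (x : ℝ) : Integrable fun y => |x - y| ^ p * basisFun L N j y :=
  integrable_abs_rpow_sub_mul hp (measurable_basisFun j).aestronglyMeasurable
    (ae_of_all _ (abs_basisFun_le hL hN j)) (support_basisFun_subset j) x

theorem potential_interpolant {s : ℝ} (hs1 : s < 1) (hL : 0 < L) (hN : 0 < N) {u g : ℝ → ℝ}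
    (hg : ∀ x, Integrable fun y => |x - y| ^ (1 - 2 * s) * g y) (m : ℤ) :
    fracConst (s - 1) * ∫ y, |node L N m - y| ^ (1 - 2 * s) * interpolant L N u g y
      = ∑ j ∈ Finset.Icc (1 : ℤ) (N - 1), u (node L N j) * omegaBar s (mesh L N) (j - m)
        + boundaryTerm s L N u g m := by
  have hb := fun j => integrable_abs_rpow_mul_basisFun (L := L) (N := N) (p := 1 - 2 * s)
    (by linarith) hL hN j (node L N m)
  have e : ∀ y, |node L N m - y| ^ (1 - 2 * s) * interpolant L N u g y
      = ∑ j ∈ Finset.Icc (1 : ℤ) (N - 1),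
          u (node L N j) * (|node L N m - y| ^ (1 - 2 * s) * basisFun L N j y)
        + |node L N m - y| ^ (1 - 2 * s) *
          (u (node L N 0) * basisFun L N 0 y + u (node L N N) * basisFun L N N y + g y) := by
    intro y
    rw [interpolant, sum_Icc_eq_interior_add hN, mul_add, mul_add, Finset.mul_sum, mul_add]
    simp only [mul_left_comm (|node L N m - y| ^ (1 - 2 * s)) (u _)]
    ring
  simp only [e]
  rw [integral_add (integrable_finsetSum _ fun j _ => (hb j).const_mul _), mul_add, boundaryTerm,
    integral_finsetSum _ fun j _ => (hb j).const_mul _, Finset.mul_sum]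
  · congr 1
    refine Finset.sum_congr rfl fun j hj => ?_
    rw [Finset.mem_Icc] at hj
    rw [← integral_basisFun_interior hL hN (by omega) (by omega), integral_const_mul]
    ring
  · refine ((((hb 0).const_mul (u (node L N 0))).add ((hb N).const_mul (u (node L N N)))).add
      (hg (node L N m))).congr (ae_of_all _ fun y => ?_)
    simp only [Pi.add_apply]
    ring

/-- The modified scheme is `(-Δ)_h` of the Riesz potential of the interpolant, up to a multiple of
`(-Δ)_h u`. -/
theorem modifiedScheme_eq {s : ℝ} (hs1 : s < 1) (hL : 0 < L) (hN : 0 < N)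
    {u g : ℝ → ℝ} (hg : ∀ x, Integrable fun y => |x - y| ^ (1 - 2 * s) * g y) {i : ℤ} (h0 : 0 < i)
    (h1 : i < N) :
    modifiedScheme s L N u g i
      = -fracConst (s - 1) *
          (∫ y, rieszKernel (1 - 2 * s) (mesh L N) (node L N i - y) * interpolant L N u g y)
        + (omegaBarM s (mesh L N) 0 - omegaBar s (mesh L N) 0) *
          discNegLap (mesh L N) (fun j => u (node L N j)) i := by
  have hI : ∀ x, Integrable fun y => |x - y| ^ (1 - 2 * s) * interpolant L N u g y := by
    intro x
    refine ((integrable_finsetSum (Finset.Icc (0 : ℤ) N) fun j _ =>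
      (integrable_abs_rpow_mul_basisFun (L := L) (N := N) (p := 1 - 2 * s)
        (by linarith) hL hN j x).const_mul (u (node L N j))).add (hg x)).congr
          (ae_of_all _ fun y => ?_)
    simp only [Pi.add_apply, interpolant, mul_add, Finset.mul_sum]
    congr 1
    exact Finset.sum_congr rfl fun j _ => by ring
  rw [← discNegLap_potential hL hN hI]
  simp only [potential_interpolant hs1 hL hN hg]
  rw [← sum_discNegLap_single (mesh L N) h0 h1 (fun j => u (node L N j)), Finset.mul_sum]
  simp only [← mul_assoc, ← weightM_sub_weight]
  rw [sum_Icc_eq_interior_add hN, modifiedScheme]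
  -- Linearity and translation: `(-Δ)_h` in `m` of `ω̄_{j-m}` is `w_{j-i}`, by the symmetry of the
  -- three-point stencil.
  have e1 : discNegLap (mesh L N) (fun m =>
      ∑ j ∈ Finset.Icc (1 : ℤ) (N - 1), u (node L N j) * omegaBar s (mesh L N) (j - m)
        + boundaryTerm s L N u g m) i
      = ∑ j ∈ Finset.Icc (1 : ℤ) (N - 1), weight s (mesh L N) (j - i) * u (node L N j)
        + discNegLap (mesh L N) (boundaryTerm s L N u g) i := by
    have e2 : ∑ j ∈ Finset.Icc (1 : ℤ) (N - 1), weight s (mesh L N) (j - i) * u (node L N j)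
        = -(∑ j ∈ Finset.Icc (1 : ℤ) (N - 1), u (node L N j) * omegaBar s (mesh L N) (j - (i - 1))
          - 2 * ∑ j ∈ Finset.Icc (1 : ℤ) (N - 1), u (node L N j) * omegaBar s (mesh L N) (j - i)
          + ∑ j ∈ Finset.Icc (1 : ℤ) (N - 1),
            u (node L N j) * omegaBar s (mesh L N) (j - (i + 1))) / mesh L N ^ 2 := by
      rw [Finset.mul_sum, ← Finset.sum_sub_distrib, ← Finset.sum_add_distrib,
        ← Finset.sum_neg_distrib, Finset.sum_div]
      refine Finset.sum_congr rfl fun j _ => ?_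
      rw [weight, discNegLap, show j - (i - 1) = j - i + 1 by ring,
        show j - (i + 1) = j - i - 1 by ring]
      ring
    rw [e2]
    simp only [discNegLap]
    ring
  rw [e1]
  simp only [sub_mul, Finset.sum_sub_distrib]
  ring

/-! ### Size of the modification and discrete norms -/

/-- The hat is at most `1`, and `|y|^(1-2s)` integrates over `[-h, h]` to `h^(2-2s) / (1 - s)`. -/
theorem abs_omegaBar_zero_le {s h : ℝ} (hs1 : s < 1) (hh : 0 < h) :
    |omegaBar s h 0| ≤ |fracConst (s - 1)| * (1 / (1 - s)) * h ^ (2 - 2 * s) := by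
  have hp : -1 < 1 - 2 * s := by linarith
  have h1 : ∫ y in (-h)..h, |y| ^ (1 - 2 * s) = 1 / (1 - s) * h ^ (2 - 2 * s) := by
    have hI := intervalIntegrable_abs_rpow hp
    have h2 := intervalIntegral.integral_comp_neg (fun y : ℝ => |y| ^ (1 - 2 * s)) (a := 0) (b := h)
    simp only [abs_neg, neg_zero] at h2
    rw [← intervalIntegral.integral_add_adjacent_intervals (hI _ 0) (hI _ _), ← h2,
      integral_abs_rpow hp hh.le, show 1 - 2 * s + 1 = 2 - 2 * s by ring]
    have : 1 - s ≠ 0 := by linarith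
    have : 2 - 2 * s ≠ 0 := by linarith
    field_simp
    ring
  rw [omegaBar, abs_mul, mul_assoc, ← h1]
  gcongr
  rw [← Real.norm_eq_abs]
  refine intervalIntegral.norm_integral_le_of_norm_le (by linarith) (ae_of_all _ fun y _ => ?_)
    (intervalIntegrable_abs_rpow hp _ _)
  have hy := hat_mem_Icc hh y
  have hr := Real.rpow_nonneg (abs_nonneg y) (1 - 2 * s)
  rw [Int.cast_zero, zero_mul, zero_sub, abs_neg, norm_mul, Real.norm_of_nonneg hr,
    Real.norm_of_nonneg hy.1]
  exact mul_le_of_le_one_right hr hy.2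

theorem abs_omegaBarM_sub_le (s h : ℝ) :
    |omegaBarM s h 0 - omegaBar s h 0| ≤ |omegaBar s h 0| := by
  unfold omegaBarM
  split_ifs
  · rw [zero_sub, abs_neg]
  · rw [sub_self, abs_zero]; exact abs_nonneg _

theorem abs_discNegLap_le {α a b M : ℝ} {u : ℝ → ℝ} (hL : 0 < L) (hN : 0 < N) (hα : 0 < α)
    (hM : 0 ≤ M) (hu : C1HolderBound α a b M u) (ha : a ≤ -L) (hb : L ≤ b) {i : ℤ} (h0 : 0 < i)
    (h1 : i < N) :
    |discNegLap (mesh L N) (fun j => u (node L N j)) i|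
      ≤ 2 * M * mesh L N ^ (1 + α) / mesh L N ^ 2 := by
  have hh := mesh_pos hL hN
  have hsub : Icc (-L) L ⊆ Icc a b := Icc_subset_Icc ha hb
  have m0 := hsub (node_mem_Icc (L := L) (N := N) (i := i) hL hN (by omega) (by omega))
  have m1 := hsub (node_mem_Icc (L := L) (N := N) (i := i + 1) hL hN (by omega) (by omega))
  have m2 := hsub (node_mem_Icc (L := L) (N := N) (i := i - 1) hL hN (by omega) (by omega))
  rw [node_add_one] at m1
  rw [node_sub_one] at m2
  have := hu.abs_symmDiff2_le hM hα m0 m1 m2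
  rw [abs_of_pos hh] at this
  rw [discNegLap, node_add_one, node_sub_one, abs_div, abs_neg, abs_of_pos (pow_pos hh 2)]
  refine div_le_div_of_nonneg_right (le_trans (le_of_eq ?_) this) (by positivity)
  rw [symmDiff2]
  congr 1; ring

theorem normTwo_le {n : ℕ} {h B : ℝ} (hh : 0 ≤ h) (hB : 0 ≤ B) {v : Fin n → ℝ}
    (hv : ∀ k, |v k| ≤ B) : normTwo h v ≤ √(h * n) * B := by
  rw [normTwo]
  refine Real.sqrt_le_iff.2 ⟨by positivity, ?_⟩
  rw [mul_pow, Real.sq_sqrt (by positivity), mul_assoc]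
  gcongr
  calc ∑ k, v k ^ 2 ≤ ∑ _k : Fin n, B ^ 2 :=
        Finset.sum_le_sum fun k _ => sq_le_sq' (abs_le.1 (hv k)).1 (abs_le.1 (hv k)).2
    _ = n * B ^ 2 := by simp

end FracScheme

/-! ### Assembling the truncation error -/

open FracScheme in
/-- Pointwise truncation error of the modified scheme. -/
theorem exists_abs_fracLap_sub_modifiedScheme_le {s α δ : ℝ} (hs0 : 0 < s) (hs1 : s < 1)
    (hs : s ≠ 1 / 2) (hα0 : 0 < α) (hαs : 2 * s - 1 < α) (hα1 : α ≤ 1) (hδ : 0 < δ) :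
    ∃ C : ℝ, 0 ≤ C ∧ ∀ (L : ℝ) (N : ℕ) (u g : ℝ → ℝ) (M : ℝ), 0 < L → 0 < N →
      (∀ x ∈ Icc (-L) L, g x = 0) → (∀ x, x ∉ Icc (-L) L → u x = g x) →
      AEStronglyMeasurable g → (∀ᵐ x, |g x| ≤ M) → Bornology.IsBounded (Function.support g) →
      C1HolderBound α (-L - δ) (L + δ) M u → ∀ i : ℤ, 0 < i → i < N →
        HasFracLap s u (node L N i) (fracLap s u (node L N i)) ∧
        |fracLap s u (node L N i) - modifiedScheme s L N u g i|
          ≤ C * M * mesh L N ^ (1 + α - 2 * s) := by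
  set p := 1 - 2 * s with hpdef
  have hp : -1 < p := by linarith
  have hp1 : p < 1 := by linarith
  set I1 := ∫ t, |rieszRem p t * |t| ^ (1 + α)|
  set I2 := ∫ t, |rieszDiff p t|
  have hI1 : 0 ≤ I1 := integral_nonneg fun _ => abs_nonneg _
  have hI2 : 0 ≤ I2 := integral_nonneg fun _ => abs_nonneg _
  have h1s : 0 < 1 - s := by linarith
  -- The three summands bound the consistency, interpolation and modification errors.
  refine ⟨|fracConst (s - 1)| * ((2 + 4 / δ ^ (1 + α)) * I1 + I2 + 1 / (1 - s) * 2),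
    by positivity, ?_⟩
  intro L N u g M hL hN hg0 hug hgm hgM hgb hu i hi0 hi1
  have hh := mesh_pos hL hN
  have hM : 0 ≤ M := hu.nonneg (by linarith)
  have hLsub : Icc (-L) L ⊆ Icc (-L - δ) (L + δ) := Icc_subset_Icc (by linarith) (by linarith)
  have hx := node_mem_Icc (i := i) hL hN (by omega) (by omega)
  have huM : ∀ᵐ y, |u y| ≤ M := by
    filter_upwards [hgM] with y hy
    by_cases h : y ∈ Icc (-L) L
    · exact hu.abs_le y (hLsub h)
    · rwa [hug y h]
  -- Glue: `u` is continuous on `[-L, L]` and equals `g` off it.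
  have hum : AEStronglyMeasurable u := by
    rw [← Measure.restrict_univ (μ := (volume : Measure ℝ)), ← union_compl_self (Icc (-L) L),
      aestronglyMeasurable_union_iff]
    refine ⟨(hu.differentiableOn.continuousOn.mono hLsub).aestronglyMeasurable measurableSet_Icc,
      hgm.restrict.congr ?_⟩
    filter_upwards [ae_restrict_mem measurableSet_Icc.compl] with y hy using (hug y hy).symm
  obtain ⟨R, hR⟩ := hgb.subset_closedBall 0
  rw [Real.closedBall_eq_Icc, zero_sub, zero_add] at hR
  have hgi := integrable_abs_rpow_sub_mul hp hgm hgM hR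
  have hA := hu.ae_abs_symmDiff2_le hM hα0 hδ huM (x := node L N i) (by simpa using hx)
  have hF := hasFracLap_of_symmDiff2_le hs0 hum huM hA (by linarith)
  refine ⟨hF.fracLap_eq.symm ▸ hF, ?_⟩
  have hcons := abs_symmetrized_sub_le hp hp1 hh (by linarith) (by linarith) (by linarith) hum huM hA
  have hint := abs_sub_interpolant_le hL hN hα0 hM hg0 hug hu (by linarith) (by linarith)
  have hkint := abs_integral_rieszKernel_mul_le hp hp1 hh (ae_of_all _ hint) (node L N i)
  set x := node L N i
  set h := mesh L N
  set κ := fracConst (s - 1)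
  have hKi := (integrable_rieszKernel hp hp1 hh).comp_sub_left x
  have hvm : AEStronglyMeasurable (interpolant L N u g) :=
    (Finset.measurable_sum (Finset.Icc (0 : ℤ) N) fun j _ =>
      (measurable_basisFun (L := L) (N := N) j).const_mul
        (u (node L N j))).aestronglyMeasurable.add hgm
  have hvM : ∀ᵐ y, |interpolant L N u g y| ≤ M + M * h ^ (1 + α) := by
    filter_upwards [huM] with y hy
    have h1 := abs_le.1 hy
    have h2 := abs_le.1 (hint y)
    rw [abs_le]
    constructor <;> linarith
  rw [show ∫ y, rieszKernel p h (x - y) * (u y - interpolant L N u g y)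
      = (∫ y, rieszKernel p h (x - y) * u y)
        - ∫ y, rieszKernel p h (x - y) * interpolant L N u g y by
    rw [← integral_sub (hKi.mul_bdd hum huM) (hKi.mul_bdd hvm hvM)]
    simp only [mul_sub]] at hkint
  have hmod : |(omegaBarM s h 0 - omegaBar s h 0) * discNegLap h (fun j => u (node L N j)) i|
      ≤ |κ| * (1 / (1 - s)) * h ^ (2 - 2 * s) * (2 * M * h ^ (1 + α) / h ^ 2) := by
    rw [abs_mul]
    gcongr
    · exact (abs_omegaBarM_sub_le s h).trans (abs_omegaBar_zero_le hs1 hh)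
    · exact abs_discNegLap_le hL hN hα0 hM hu (by linarith) (by linarith) hi0 hi1
  rw [hF.fracLap_eq, modifiedScheme_eq hs1 hL hN hgi hi0 hi1,
    fracConst_eq_mul_fracConst_sub_one hs0 hs1 hs, show -(1 + 2 * s) = p - 2 by rw [hpdef]; ring,
    show -(2 * s) = p - 1 by rw [hpdef]; ring, ← hpdef]
  set J := ∫ z, symmDiff2 u x z * |z| ^ (p - 2)
  set Ku := ∫ y, rieszKernel p h (x - y) * u y
  set Kv := ∫ y, rieszKernel p h (x - y) * interpolant L N u g y
  set E := (omegaBarM s h 0 - omegaBar s h 0) * discNegLap h (fun j => u (node L N j)) i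
  -- The three-term splitting of the error.
  have e : -(κ * (p * (p - 1)) / 2) * J - (-κ * Kv + E)
      = -(κ * (p * (p - 1) / 2 * J - Ku)) + (-(κ * (Ku - Kv)) + -E) := by ring
  have q1 : h ^ (p - 1 + (1 + α)) = h ^ (1 + α - 2 * s) := by rw [hpdef]; congr 1; ring
  have q2 : h ^ (1 + α) * h ^ (p - 1) = h ^ (1 + α - 2 * s) := by
    rw [← Real.rpow_add hh, hpdef]; congr 1; ring
  have q3 : h ^ (2 - 2 * s) * (h ^ (1 + α) / h ^ 2) = h ^ (1 + α - 2 * s) := by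
    rw [← Real.rpow_ofNat, ← Real.rpow_sub hh, ← Real.rpow_add hh]; congr 1; ring
  rw [e]
  refine (abs_add_le _ _).trans (add_le_add_right (abs_add_le _ _) _) |>.trans ?_
  rw [abs_neg, abs_neg, abs_neg, abs_mul, abs_mul]
  calc |κ| * |p * (p - 1) / 2 * J - Ku| + (|κ| * |Ku - Kv| + |E|)
      ≤ |κ| * ((2 + 4 / δ ^ (1 + α)) * M * h ^ (p - 1 + (1 + α)) * I1)
        + (|κ| * (M * h ^ (1 + α) * h ^ (p - 1) * I2)
          + |κ| * (1 / (1 - s)) * h ^ (2 - 2 * s) * (2 * M * h ^ (1 + α) / h ^ 2)) := by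
        gcongr
    _ = |κ| * (2 + 4 / δ ^ (1 + α)) * I1 * M * h ^ (p - 1 + (1 + α))
        + (|κ| * I2 * M * (h ^ (1 + α) * h ^ (p - 1))
          + |κ| * (1 / (1 - s)) * 2 * M * (h ^ (2 - 2 * s) * (h ^ (1 + α) / h ^ 2))) := by ring
    _ = _ := by rw [q1, q2, q3]; ring

end

theorem mainTheorem7 (s α L δ : ℝ) (hs0 : 0 < s) (hs1 : s < 1) (hs : s ≠ 1 / 2)
    (hα : max 0 (2 * s - 1) < α) (hα1 : α ≤ 1) (hL : 0 < L) (hδ : 0 < δ) :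
    ∃ C : ℝ, 0 < C ∧ ∀ (u g : ℝ → ℝ) (M : ℝ),
      (∀ x ∈ Icc (-L) L, g x = 0) → (∀ x, x ∉ Icc (-L) L → u x = g x) →
      MemLp g ⊤ volume → (∀ᵐ x ∂(volume : Measure ℝ), |g x| ≤ M) →
      Bornology.IsBounded (Function.support g) →
      C1HolderBound α (-L - δ) (L + δ) M u →
      ∀ N : ℕ, 0 < N → 4 * FracScheme.mesh L N < δ →
        (∀ i : ℤ, 0 < i → i < N →
          HasFracLap s u (FracScheme.node L N i) (fracLap s u (FracScheme.node L N i))) ∧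
        FracScheme.normInf (FracScheme.truncError s L N u g)
          ≤ C * M * FracScheme.mesh L N ^ (1 + α - 2 * s) ∧
        FracScheme.normTwo (FracScheme.mesh L N) (FracScheme.truncError s L N u g)
          ≤ C * M * FracScheme.mesh L N ^ (1 + α - 2 * s) := by
  obtain ⟨C, hC, h⟩ := exists_abs_fracLap_sub_modifiedScheme_le hs0 hs1 hs
    ((le_max_left _ _).trans_lt hα) ((le_max_right _ _).trans_lt hα) hα1 hδ
  -- `C + 1` ensures positivity; the second factor dominates both `1` (uniform norm) and `√(2L)`
  -- (`l²` norm).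
  refine ⟨(C + 1) * (1 + √(2 * L)), by positivity, ?_⟩
  intro u g M hg0 hug hgm hgM hgb hu N hN _
  have hM : 0 ≤ M := hu.nonneg (by linarith)
  have hh := FracScheme.mesh_pos hL hN
  have key := h L N u g M hL hN hg0 hug hgm.1 hgM hgb hu
  have hE : ∀ k, |FracScheme.truncError s L N u g k| ≤ C * M * FracScheme.mesh L N ^ (1 + α - 2 * s) := fun k =>
    (key _ (by omega) (by omega)).2
  have hq := Real.rpow_pos_of_pos hh (1 + α - 2 * s)
  have hr := Real.sqrt_nonneg (2 * L)
  refine ⟨fun i h0 h1 => (key i h0 h1).1, ?_, ?_⟩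
  · refine (pi_norm_le_iff_of_nonneg (by positivity)).2 fun k => (hE k).trans ?_
    gcongr
    nlinarith
  · refine (FracScheme.normTwo_le hh.le (by positivity) hE).trans ?_
    -- There are `N - 1` interior nodes, and `h (N - 1) ≤ h N = 2L`.
    have h1 : √(FracScheme.mesh L N * (N - 1 : ℕ)) ≤ √(2 * L) := by
      apply Real.sqrt_le_sqrt
      rw [← FracScheme.mul_mesh (L := L) hN, mul_comm]
      gcongr
      omega
    calc √(FracScheme.mesh L N * (N - 1 : ℕ)) * (C * M * FracScheme.mesh L N ^ (1 + α - 2 * s))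
        ≤ √(2 * L) * (C * M * FracScheme.mesh L N ^ (1 + α - 2 * s)) := by gcongr
      _ = C * √(2 * L) * M * FracScheme.mesh L N ^ (1 + α - 2 * s) := by ring
      _ ≤ _ := by
        have h2 : C * √(2 * L) ≤ (C + 1) * (1 + √(2 * L)) := by nlinarith
        exact mul_le_mul_of_nonneg_right (mul_le_mul_of_nonneg_right h2 hM) hq.le
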